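/- Let $L,\rho_1,\rho_2,k_1,k_2>0$, $0<\alpha<1$, $\eta\ge 0$, and put $\mu(\xi)=|\xi|^{(2\alpha-1)/2}$ for $\xi\in\mathbb R$ and $\mathfrak C=\pi^{-1}\sin(\alpha\pi)$. All function spaces are complex. Let $$\mathbb H^1_0=\{(u,v)\in H^1(-L,0)\times H^1(0,L):\ u(-L)=v(L)=0,\ u(0)=v(0)\},$$ $$\mathcal H=\mathbb H^1_0\times\big(L^2(-L,0)\times L^2(0,L)\big)\times\big(L^2(\mathbb R;L^2(-L,0))\times L^2(\mathbb R;L^2(0,L))\big),$$ with the norm given, for $\mathbb U=(u,v,U,V,\varphi_1,\varphi_2)$, by $$\|\mathbb U\|_{\mathcal H}^2=\rho_1\|U\|^2+k_1\|u_x\|^2+\rho_2\|V\|^2+k_2\|v_x\|^2+\mathfrak C\|\varphi_1\|^2+\mathfrak C\|\varphi_2\|^2 ,$$ where the norms on the right are those of $L^2(-L,0)$, $L^2(0,L)$, $L^2(\mathbb R;L^2(-L,0))$ and $L^2(\mathbb R;L^2(0,L))$. Let $\mathcal A:\mathcal D(\mathcal A)\subset\mathcal H\to\mathcal H$ be the unbounded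 linear operator $$\mathcal A\mathbb U=\Big(U,\ V,\ \tfrac1{\rho_1}\big[k_1u_{xx}-\mathfrak C\!\int_{\mathbb R}\mu(\xi)\varphi_1(\xi)\,d\xi\big],\ \tfrac1{\rho_2}\big[k_2v_{xx}-\mathfrak C\!\int_{\mathbb R}\mu(\xi)\varphi_2(\xi)\,d\xi\big],\ -(|\xi|^2+\eta)\varphi_1+\mu(\xi)U,\ -(|\xi|^2+\eta)\varphi_2+\mu(\xi)V\Big),$$ whose domain consists of all $\mathbb U=(u,v,U,V,\varphi_1,\varphi_2)\in\mathcal H$ such that $(U,V)\in\mathbb H^1_0$, $u\in H^2(-L,0)$, $v\in H^2(0,L)$, $k_1u_x(0)=k_2v_x(0)$, the functions $|\xi|\varphi_1$ and $-(|\xi|^2+\eta)\varphi_1+\mu(\xi)U$ belong to $L^2(\mathbb R;L^2(-L,0))$, and the functions $|\xi|\varphi_2$ and $-(|\xi|^2+\eta)\varphi_2+\mu(\xi)V$ belong to $L^2(\mathbb R;L^2(0,L))$. (a) If $\eta=0$, then for every real $\lambda\neq0$ the operator $i\lambda I-\mathcal A:\mathcal D(\mathcal A)\to\mathcal H$ is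 surjective; moreover $i\lambda\notin\sigma(\mathcal A)$, that is, $i\lambda I-\mathcal A$ is a bijection of $\mathcal D(\mathcal A)$ onto $\mathcal H$ with bounded inverse. (b) If $\eta>0$, then for every real $\lambda$ the operator $i\lambda I-\mathcal A:\mathcal D(\mathcal A)\to\mathcal H$ is surjective; moreover $i\lambda\notin\sigma(\mathcal A)$ in the same sense. -/

import Mathlib

open MeasureTheory Set
open scoped ENNReal ContDiff

noncomputable section

namespace Transmission

/-! ### Sobolev spaces on a bounded interval -/

/-- The complex Lebesgue space `L²(a, b)`. -/
abbrev L2 (a b : ℝ) : Type := Lp ℂ 2 (volume.restrict (Ioo a b))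

/-- The Bochner space `L²(ℝ; L²(a, b))`. -/
abbrev LL2 (a b : ℝ) : Type := Lp (L2 a b) 2 (volume : Measure ℝ)

/-- `w ∈ L²(a, b)` is the weak derivative of `u ∈ L²(a, b)`: `∫ u φ' = - ∫ w φ` for all smooth `φ`
with compact support in `(a, b)`. -/
def HasWeakDeriv {a b : ℝ} (u w : L2 a b) : Prop :=
  ∀ φ : ℝ → ℝ, ContDiff ℝ ∞ φ → HasCompactSupport φ → tsupport φ ⊆ Ioo a b →
    ∫ x in Ioo a b, deriv φ x • u x = - ∫ x in Ioo a b, φ x • w x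

theorem integrable_test {a b : ℝ} (u : L2 a b) {φ : ℝ → ℝ} (h : Continuous φ)
    (hc : HasCompactSupport φ) :
    Integrable (fun x => φ x • u x) (volume.restrict (Ioo a b)) :=
  (((Lp.memLp u).integrable one_le_two).locallyIntegrable).integrable_smul_left_of_hasCompactSupport
    h hc

theorem HasWeakDeriv.add {a b : ℝ} {u w u' w' : L2 a b} (h : HasWeakDeriv u w)
    (h' : HasWeakDeriv u' w') : HasWeakDeriv (u + u') (w + w') := by
  intro φ hφ hc hs
  have e1 : ∫ x in Ioo a b, deriv φ x • (u + u') x =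
      ∫ x in Ioo a b, (deriv φ x • u x + deriv φ x • u' x) := by
    apply integral_congr_ae
    filter_upwards [Lp.coeFn_add u u'] with x hx
    simp only [hx, Pi.add_apply, smul_add]
  have e2 : ∫ x in Ioo a b, φ x • (w + w') x =
      ∫ x in Ioo a b, (φ x • w x + φ x • w' x) := by
    apply integral_congr_ae
    filter_upwards [Lp.coeFn_add w w'] with x hx
    simp only [hx, Pi.add_apply, smul_add]
  have hd : Continuous (deriv φ) := hφ.continuous_deriv (by norm_num)
  rw [e1, e2, integral_add (integrable_test u hd hc.deriv) (integrable_test u' hd hc.deriv),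
    integral_add (integrable_test w hφ.continuous hc) (integrable_test w' hφ.continuous hc),
    h φ hφ hc hs, h' φ hφ hc hs]
  ring

theorem HasWeakDeriv.smul {a b : ℝ} {u w : L2 a b} (c : ℂ) (h : HasWeakDeriv u w) :
    HasWeakDeriv (c • u) (c • w) := by
  intro φ hφ hc hs
  have e1 : ∫ x in Ioo a b, deriv φ x • (c • u) x =
      ∫ x in Ioo a b, c • (deriv φ x • u x) := by
    apply integral_congr_ae
    filter_upwards [Lp.coeFn_smul c u] with x hx
    simp only [hx, Pi.smul_apply]
    rw [smul_comm]
  have e2 : ∫ x in Ioo a b, φ x • (c • w) x =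
      ∫ x in Ioo a b, c • (φ x • w x) := by
    apply integral_congr_ae
    filter_upwards [Lp.coeFn_smul c w] with x hx
    simp only [hx, Pi.smul_apply]
    rw [smul_comm]
  rw [e1, e2, integral_smul, integral_smul, h φ hφ hc hs, smul_neg]

theorem HasWeakDeriv.zero {a b : ℝ} : HasWeakDeriv (0 : L2 a b) 0 := by
  intro φ _ _ _
  have e : ∀ ψ : ℝ → ℝ, ∫ x in Ioo a b, ψ x • (0 : L2 a b) x = 0 := by
    intro ψ
    rw [← integral_zero ℝ ℂ (μ := volume.restrict (Ioo a b))]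
    apply integral_congr_ae
    filter_upwards [Lp.coeFn_zero ℂ 2 (volume.restrict (Ioo a b))] with x hx
    rw [hx]
    simp only [Pi.zero_apply, smul_zero]
  rw [e, e, neg_zero]

theorem HasWeakDeriv.unique {a b : ℝ} {u w w' : L2 a b} (h : HasWeakDeriv u w)
    (h' : HasWeakDeriv u w') : w = w' := by
  have key : ∀ᵐ x ∂(volume.restrict (Ioo a b)), x ∈ Ioo a b → (w x - w' x) = 0 := by
    refine isOpen_Ioo.ae_eq_zero_of_integral_contDiff_smul_eq_zero ?_ ?_
    · exact ((((Lp.memLp w).integrable one_le_two).sub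
        ((Lp.memLp w').integrable one_le_two)).locallyIntegrable).locallyIntegrableOn _
    · intro g hg hc hs
      have e := (h g hg hc hs).symm.trans (h' g hg hc hs)
      simp only [smul_sub]
      rw [integral_sub (integrable_test w hg.continuous hc) (integrable_test w' hg.continuous hc),
        neg_injective e, sub_self]
  apply Lp.ext
  filter_upwards [key, ae_restrict_mem measurableSet_Ioo] with x hx hm
  exact sub_eq_zero.1 (hx hm)

/-- The Sobolev space `H¹(a, b)`, as a subspace of `L²(a, b)`. -/
def H1 (a b : ℝ) : Submodule ℂ (L2 a b) where
  carrier := {u | ∃ w, HasWeakDeriv u w}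
  add_mem' := fun ⟨w, h⟩ ⟨w', h'⟩ => ⟨w + w', h.add h'⟩
  zero_mem' := ⟨0, HasWeakDeriv.zero⟩
  smul_mem' := fun c _ ⟨w, h⟩ => ⟨c • w, h.smul c⟩

/-- The weak derivative `H¹(a, b) → L²(a, b)`. -/
def weakDeriv (a b : ℝ) : H1 a b →ₗ[ℂ] L2 a b where
  toFun u := u.2.choose
  map_add' u v := (u + v).2.choose_spec.unique (u.2.choose_spec.add v.2.choose_spec)
  map_smul' c u := (c • u).2.choose_spec.unique (u.2.choose_spec.smul c)

/-- The Sobolev space `H²(a, b)`, as a subspace of `H¹(a, b)`. -/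
def H2 (a b : ℝ) : Submodule ℂ (H1 a b) := (H1 a b).comap (weakDeriv a b)

/-- The first derivative of an element of `H²(a, b)`, as an element of `H¹(a, b)`. -/
def deriv1 (a b : ℝ) : H2 a b →ₗ[ℂ] H1 a b :=
  ((weakDeriv a b).comp (H2 a b).subtype).codRestrict (H1 a b) (fun u => u.2)

/-- The second derivative of an element of `H²(a, b)`. -/
def deriv2 (a b : ℝ) : H2 a b →ₗ[ℂ] L2 a b := (weakDeriv a b).comp (deriv1 a b)

/-- The pointwise value `u(p) = c` of `u` at a point `p` of `[a, b]`: `u` has a representative that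
is continuous on `[a, b]` and takes the value `c` at `p`. -/
def HasValue {a b : ℝ} (u : L2 a b) (p : ℝ) (c : ℂ) : Prop :=
  ∃ g : ℝ → ℂ, ContinuousOn g (Icc a b) ∧ u =ᵐ[volume.restrict (Ioo a b)] g ∧ g p = c

theorem HasValue.add {a b : ℝ} {u v : L2 a b} {p : ℝ} {c d : ℂ} (h : HasValue u p c)
    (h' : HasValue v p d) : HasValue (u + v) p (c + d) := by
  obtain ⟨g, hg, hu, hc⟩ := h
  obtain ⟨k, hk, hv, hd⟩ := h'
  refine ⟨g + k, hg.add hk, ?_, by simp [hc, hd]⟩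
  exact (Lp.coeFn_add u v).trans (hu.add hv)

theorem HasValue.smul {a b : ℝ} {u : L2 a b} {p : ℝ} {c : ℂ} (z : ℂ) (h : HasValue u p c) :
    HasValue (z • u) p (z * c) := by
  obtain ⟨g, hg, hu, hc⟩ := h
  refine ⟨z • g, hg.const_smul z, ?_, by simp [hc]⟩
  exact (Lp.coeFn_smul z u).trans (hu.const_smul z)

theorem HasValue.zero {a b p : ℝ} : HasValue (0 : L2 a b) p 0 :=
  ⟨0, continuousOn_const, Lp.coeFn_zero ℂ 2 (volume.restrict (Ioo a b)), rfl⟩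

/-! ### The phase space -/

/-- The space of all `(u, v) ∈ H¹(-L, 0) × H¹(0, L)` with `u(-L) = v(L) = 0` and `u(0) = v(0)`. -/
def H10 (L : ℝ) : Submodule ℂ (L2 (-L) 0 × L2 0 L) where
  carrier := {p | p.1 ∈ H1 (-L) 0 ∧ p.2 ∈ H1 0 L ∧ HasValue p.1 (-L) 0 ∧ HasValue p.2 L 0 ∧
    ∃ c, HasValue p.1 0 c ∧ HasValue p.2 0 c}
  add_mem' := by
    rintro p q ⟨h1, h2, h3, h4, c, h5, h6⟩ ⟨k1, k2, k3, k4, d, k5, k6⟩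
    exact ⟨add_mem h1 k1, add_mem h2 k2, by simpa using h3.add k3, by simpa using h4.add k4,
      c + d, h5.add k5, h6.add k6⟩
  zero_mem' := ⟨zero_mem _, zero_mem _, HasValue.zero, HasValue.zero, 0, HasValue.zero,
    HasValue.zero⟩
  smul_mem' := by
    rintro z p ⟨h1, h2, h3, h4, c, h5, h6⟩
    exact ⟨Submodule.smul_mem _ z h1, Submodule.smul_mem _ z h2, by simpa using h3.smul z,
      by simpa using h4.smul z, z * c, h5.smul z, h6.smul z⟩

/-- The phase space `H¹₀ × (L² × L²) × (L²(ℝ; L²) × L²(ℝ; L²))`, with elements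
`((u, v), (U, V), (φ₁, φ₂))`. Its norm is `energyNorm` below (a `def` is used so that the topology
of the ambient product is not inherited). -/
def PhaseSpace (L : ℝ) : Type :=
  H10 L × (L2 (-L) 0 × L2 0 L) × (LL2 (-L) 0 × LL2 0 L)

instance (L : ℝ) : AddCommGroup (PhaseSpace L) :=
  inferInstanceAs (AddCommGroup (H10 L × (L2 (-L) 0 × L2 0 L) × (LL2 (-L) 0 × LL2 0 L)))

instance (L : ℝ) : Module ℂ (PhaseSpace L) :=
  inferInstanceAs (Module ℂ (H10 L × (L2 (-L) 0 × L2 0 L) × (LL2 (-L) 0 × LL2 0 L)))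

namespace PhaseSpace

variable {L : ℝ}

/-- The pair of displacements `(u, v)`. -/
def uv : PhaseSpace L →ₗ[ℂ] H10 L := LinearMap.fst ℂ _ _

/-- The displacement `u ∈ H¹(-L, 0)`. -/
def u : PhaseSpace L →ₗ[ℂ] H1 (-L) 0 :=
  ((LinearMap.fst ℂ _ _ ∘ₗ (H10 L).subtype).codRestrict _ (fun p => p.2.1)) ∘ₗ uv

/-- The displacement `v ∈ H¹(0, L)`. -/
def v : PhaseSpace L →ₗ[ℂ] H1 0 L :=
  ((LinearMap.snd ℂ _ _ ∘ₗ (H10 L).subtype).codRestrict _ (fun p => p.2.2.1)) ∘ₗ uv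

/-- The pair of velocities `(U, V)`. -/
def UV : PhaseSpace L →ₗ[ℂ] L2 (-L) 0 × L2 0 L := LinearMap.fst ℂ _ _ ∘ₗ LinearMap.snd ℂ _ _

/-- The velocity `U`. -/
def U : PhaseSpace L →ₗ[ℂ] L2 (-L) 0 := LinearMap.fst ℂ _ _ ∘ₗ UV

/-- The velocity `V`. -/
def V : PhaseSpace L →ₗ[ℂ] L2 0 L := LinearMap.snd ℂ _ _ ∘ₗ UV

/-- The memory variable `φ₁`. -/
def φ₁ : PhaseSpace L →ₗ[ℂ] LL2 (-L) 0 :=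
  LinearMap.fst ℂ _ _ ∘ₗ LinearMap.snd ℂ _ _ ∘ₗ LinearMap.snd ℂ _ _

/-- The memory variable `φ₂`. -/
def φ₂ : PhaseSpace L →ₗ[ℂ] LL2 0 L :=
  LinearMap.snd ℂ _ _ ∘ₗ LinearMap.snd ℂ _ _ ∘ₗ LinearMap.snd ℂ _ _

end PhaseSpace

/-- The constant `π⁻¹ sin(α π)`. -/
def frakC (α : ℝ) : ℝ := Real.pi⁻¹ * Real.sin (α * Real.pi)

/-- The energy norm of the phase space. -/
def energyNorm (L ρ₁ ρ₂ k₁ k₂ α : ℝ) (X : PhaseSpace L) : ℝ :=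
  Real.sqrt (ρ₁ * ‖X.U‖ ^ 2 + k₁ * ‖weakDeriv (-L) 0 X.u‖ ^ 2
    + ρ₂ * ‖X.V‖ ^ 2 + k₂ * ‖weakDeriv 0 L X.v‖ ^ 2
    + frakC α * ‖X.φ₁‖ ^ 2 + frakC α * ‖X.φ₂‖ ^ 2)

/-! ### The memory terms -/

/-- The weight `μ(ξ) = |ξ|^((2α - 1)/2)`. -/
def mu (α ξ : ℝ) : ℝ := |ξ| ^ ((2 * α - 1) / 2)

/-- The function `ξ ↦ -(|ξ|² + η) φ(ξ) + μ(ξ) W`. -/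
def memoryRate {a b : ℝ} (α η : ℝ) (φ : LL2 a b) (W : L2 a b) (ξ : ℝ) : L2 a b :=
  (-(|ξ| ^ 2 + η)) • φ ξ + mu α ξ • W

/-- The pairs `(φ, W)` with `|ξ| φ ∈ L²(ℝ; L²(a, b))` and
`-(|ξ|² + η) φ + μ(ξ) W ∈ L²(ℝ; L²(a, b))`. -/
def MemoryCond {a b : ℝ} (α η : ℝ) (φ : LL2 a b) (W : L2 a b) : Prop :=
  MemLp (fun ξ : ℝ => |ξ| • φ ξ) 2 volume ∧ MemLp (memoryRate α η φ W) 2 volume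

theorem memoryRate_add {a b α η : ℝ} (φ ψ : LL2 a b) (W Z : L2 a b) :
    memoryRate α η (φ + ψ) (W + Z) =ᵐ[volume] memoryRate α η φ W + memoryRate α η ψ Z := by
  filter_upwards [Lp.coeFn_add φ ψ] with ξ hξ
  simp only [memoryRate, hξ, Pi.add_apply, smul_add]
  abel

theorem memoryRate_smul {a b α η : ℝ} (c : ℂ) (φ : LL2 a b) (W : L2 a b) :
    memoryRate α η (c • φ) (c • W) =ᵐ[volume] c • memoryRate α η φ W := by
  filter_upwards [Lp.coeFn_smul c φ] with ξ hξ
  simp only [memoryRate, hξ, Pi.smul_apply, smul_add]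
  rw [smul_comm c, smul_comm c]

theorem MemoryCond.add {a b α η : ℝ} {φ ψ : LL2 a b} {W Z : L2 a b} (h : MemoryCond α η φ W)
    (k : MemoryCond α η ψ Z) : MemoryCond α η (φ + ψ) (W + Z) := by
  refine ⟨(h.1.add k.1).ae_eq ?_, (h.2.add k.2).ae_eq (memoryRate_add φ ψ W Z).symm⟩
  filter_upwards [Lp.coeFn_add φ ψ] with ξ hξ
  simp only [hξ, Pi.add_apply, smul_add]

theorem MemoryCond.smul {a b α η : ℝ} {φ : LL2 a b} {W : L2 a b} (c : ℂ)
    (h : MemoryCond α η φ W) : MemoryCond α η (c • φ) (c • W) := by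
  refine ⟨(h.1.const_smul c).ae_eq ?_, (h.2.const_smul c).ae_eq (memoryRate_smul c φ W).symm⟩
  filter_upwards [Lp.coeFn_smul c φ] with ξ hξ
  simp only [hξ, Pi.smul_apply]
  rw [smul_comm]

theorem MemoryCond.zero {a b α η : ℝ} : MemoryCond α η (0 : LL2 a b) (0 : L2 a b) := by
  constructor
  · refine (MemLp.zero (ε := L2 a b)).ae_eq ?_
    filter_upwards [Lp.coeFn_zero (L2 a b) 2 (volume : Measure ℝ)] with ξ hξ
    simp
  · refine (MemLp.zero (ε := L2 a b)).ae_eq ?_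
    filter_upwards [Lp.coeFn_zero (L2 a b) 2 (volume : Measure ℝ)] with ξ hξ
    simp [memoryRate]

/-- The output `∫ μ(ξ) φ(ξ) dξ`, a Bochner integral in `L²(a, b)`. -/
def memoryOutput {a b : ℝ} (α : ℝ) (φ : LL2 a b) : L2 a b := ∫ ξ : ℝ, mu α ξ • φ ξ

theorem memLp_weight {α : ℝ} (hα : α ∈ Ioo (0 : ℝ) 1) :
    MemLp (fun ξ : ℝ => mu α ξ / (1 + |ξ|)) 2 volume := by
  have hm : Measurable (fun ξ : ℝ => mu α ξ / (1 + |ξ|)) := by unfold mu; fun_prop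
  rw [memLp_two_iff_integrable_sq hm.aestronglyMeasurable]
  have hI : IntegrableOn (fun ξ : ℝ => (mu α ξ / (1 + |ξ|)) ^ 2) (Ioi 0) := by
    rw [← Ioc_union_Ioi_eq_Ioi (zero_le_one (α := ℝ))]
    have hsq : ∀ ξ : ℝ, 0 < ξ → mu α ξ ^ 2 = ξ ^ (2 * α - 1) := by
      intro ξ hξ
      rw [mu, abs_of_pos hξ, ← Real.rpow_natCast, ← Real.rpow_mul hξ.le]
      congr 1
      push_cast
      ring
    refine IntegrableOn.union ?_ ?_
    · have h1 : IntegrableOn (fun ξ : ℝ => ξ ^ (2 * α - 1)) (Ioc 0 1) :=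
        (intervalIntegrable_iff_integrableOn_Ioc_of_le zero_le_one).1
          (intervalIntegral.intervalIntegrable_rpow' (by linarith [hα.1]))
      refine Integrable.mono' h1 (hm.pow_const 2).aestronglyMeasurable ?_
      filter_upwards [ae_restrict_mem measurableSet_Ioc] with ξ hξ
      rw [Real.norm_of_nonneg (sq_nonneg _), div_pow, hsq ξ hξ.1]
      apply div_le_self (Real.rpow_nonneg hξ.1.le _)
      nlinarith [abs_nonneg ξ]
    · have h1 : IntegrableOn (fun ξ : ℝ => ξ ^ (2 * α - 3)) (Ioi 1) :=
        integrableOn_Ioi_rpow_of_lt (by linarith [hα.2]) zero_lt_one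
      refine Integrable.mono' h1 (hm.pow_const 2).aestronglyMeasurable ?_
      filter_upwards [ae_restrict_mem measurableSet_Ioi] with ξ hξ
      have hp : (0 : ℝ) < ξ := lt_trans zero_lt_one hξ
      rw [Real.norm_of_nonneg (sq_nonneg _), div_pow, hsq ξ hp, abs_of_pos hp,
        show 2 * α - 3 = 2 * α - 1 - (2 : ℕ) by push_cast; ring, Real.rpow_sub_natCast hp.ne']
      apply div_le_div_of_nonneg_left (Real.rpow_nonneg hp.le _) (by positivity)
      nlinarith
  have hE : ∀ ξ : ℝ, (mu α (-ξ) / (1 + |(-ξ)|)) ^ 2 = (mu α ξ / (1 + |ξ|)) ^ 2 := by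
    intro ξ
    rw [mu, mu, abs_neg]
  have hN : IntegrableOn (fun ξ : ℝ => (mu α ξ / (1 + |ξ|)) ^ 2) (Iio 0) := by
    rw [← neg_zero] at hI
    have h0 := IntegrableOn.comp_neg_Iio (c := (0 : ℝ)) hI
    simp only [hE] at h0
    exact h0
  have hN' : IntegrableOn (fun ξ : ℝ => (mu α ξ / (1 + |ξ|)) ^ 2) (Iic 0) :=
    (integrableOn_Iic_iff_integrableOn_Iio (by simp)).2 hN
  rw [← integrableOn_univ, ← Iic_union_Ioi (a := (0 : ℝ))]
  exact hN'.union hI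

theorem integrable_memory {a b α : ℝ} (hα : α ∈ Ioo (0 : ℝ) 1) (φ : LL2 a b)
    (h : MemLp (fun ξ : ℝ => |ξ| • φ ξ) 2 volume) :
    Integrable (fun ξ : ℝ => mu α ξ • φ ξ) volume := by
  have h1 := (MemLp.smul (r := 1) ((Lp.memLp φ).add h) (memLp_weight hα))
  rw [memLp_one_iff_integrable] at h1
  refine h1.congr (Filter.Eventually.of_forall fun ξ => ?_)
  have hp : (1 + |ξ|) ≠ 0 := by positivity
  simp only [Pi.smul_apply', Pi.add_apply]
  rw [← one_smul ℝ (φ ξ), smul_smul, mul_one, ← add_smul, smul_smul, div_mul_cancel₀ _ hp,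
    one_smul]

theorem memoryOutput_add {a b α : ℝ} (hα : α ∈ Ioo (0 : ℝ) 1) (φ ψ : LL2 a b)
    (h : MemLp (fun ξ : ℝ => |ξ| • φ ξ) 2 volume) (k : MemLp (fun ξ : ℝ => |ξ| • ψ ξ) 2 volume) :
    memoryOutput α (φ + ψ) = memoryOutput α φ + memoryOutput α ψ := by
  unfold memoryOutput
  rw [← integral_add (integrable_memory hα φ h) (integrable_memory hα ψ k)]
  apply integral_congr_ae
  filter_upwards [Lp.coeFn_add φ ψ] with ξ hξ
  simp only [hξ, Pi.add_apply, smul_add]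

theorem memoryOutput_smul {a b α : ℝ} (c : ℂ) (φ : LL2 a b) :
    memoryOutput α (c • φ) = c • memoryOutput α φ := by
  unfold memoryOutput
  rw [← integral_smul]
  apply integral_congr_ae
  filter_upwards [Lp.coeFn_smul c φ] with ξ hξ
  simp only [hξ, Pi.smul_apply]
  rw [smul_comm]

/-! ### The operator -/

/-- The domain of the operator: `(U, V) ∈ H¹₀`, `u` and `v` in `H²`, `k₁ u_x(0) = k₂ v_x(0)`, and
the two conditions on each memory variable. -/
def domainA (L k₁ k₂ α η : ℝ) : Submodule ℂ (PhaseSpace L) where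
  carrier := {X | X.UV ∈ H10 L ∧ X.u ∈ H2 (-L) 0 ∧ X.v ∈ H2 0 L ∧
    (∃ p q : ℂ, HasValue (weakDeriv (-L) 0 X.u) 0 p ∧ HasValue (weakDeriv 0 L X.v) 0 q ∧
      (k₁ : ℂ) * p = (k₂ : ℂ) * q) ∧
    MemoryCond α η X.φ₁ X.U ∧ MemoryCond α η X.φ₂ X.V}
  add_mem' := by
    rintro X Y ⟨h1, h2, h3, ⟨p, q, hp, hq, hpq⟩, h4, h5⟩ ⟨k1, k2, k3, ⟨r, s, kr, ks, krs⟩, k4, k5⟩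
    refine ⟨?_, ?_, ?_, ⟨p + r, q + s, ?_, ?_, ?_⟩, ?_, ?_⟩
    · rw [map_add]; exact add_mem h1 k1
    · rw [map_add]; exact add_mem h2 k2
    · rw [map_add]; exact add_mem h3 k3
    · rw [map_add, map_add]; exact hp.add kr
    · rw [map_add, map_add]; exact hq.add ks
    · rw [mul_add, mul_add, hpq, krs]
    · rw [map_add, map_add]; exact h4.add k4
    · rw [map_add, map_add]; exact h5.add k5
  zero_mem' := by
    refine ⟨?_, ?_, ?_, ⟨0, 0, ?_, ?_, ?_⟩, ?_, ?_⟩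
    · rw [map_zero]; exact zero_mem _
    · rw [map_zero]; exact zero_mem _
    · rw [map_zero]; exact zero_mem _
    · rw [map_zero, map_zero]; exact HasValue.zero
    · rw [map_zero, map_zero]; exact HasValue.zero
    · simp
    · rw [map_zero, map_zero]; exact MemoryCond.zero
    · rw [map_zero, map_zero]; exact MemoryCond.zero
  smul_mem' := by
    rintro c X ⟨h1, h2, h3, ⟨p, q, hp, hq, hpq⟩, h4, h5⟩
    refine ⟨?_, ?_, ?_, ⟨c * p, c * q, ?_, ?_, ?_⟩, ?_, ?_⟩
    · rw [map_smul]; exact Submodule.smul_mem _ c h1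
    · rw [map_smul]; exact Submodule.smul_mem _ c h2
    · rw [map_smul]; exact Submodule.smul_mem _ c h3
    · rw [map_smul, map_smul]; exact hp.smul c
    · rw [map_smul, map_smul]; exact hq.smul c
    · rw [mul_left_comm, hpq, mul_left_comm]
    · rw [map_smul, map_smul]; exact h4.smul c
    · rw [map_smul, map_smul]; exact h5.smul c

/-- The operator
`A (u, v, U, V, φ₁, φ₂) = (U, V, ρ₁⁻¹ (k₁ u_xx - C ∫ μ φ₁ dξ), ρ₂⁻¹ (k₂ v_xx - C ∫ μ φ₂ dξ),
-(|ξ|² + η) φ₁ + μ U, -(|ξ|² + η) φ₂ + μ V)`, an unbounded operator in the phase space. -/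
def opA (L ρ₁ ρ₂ k₁ k₂ α η : ℝ) (hα : α ∈ Ioo (0 : ℝ) 1) : PhaseSpace L →ₗ.[ℂ] PhaseSpace L where
  domain := domainA L k₁ k₂ α η
  toFun :=
    { toFun := fun X =>
        (⟨X.1.UV, X.2.1⟩,
          (ρ₁⁻¹ • (k₁ • deriv2 (-L) 0 ⟨X.1.u, X.2.2.1⟩ - frakC α • memoryOutput α X.1.φ₁),
            ρ₂⁻¹ • (k₂ • deriv2 0 L ⟨X.1.v, X.2.2.2.1⟩ - frakC α • memoryOutput α X.1.φ₂)),
          (X.2.2.2.2.2.1.2.toLp _, X.2.2.2.2.2.2.2.toLp _))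
      map_add' := by
        intro X Y
        refine Prod.ext ?_ (Prod.ext (Prod.ext ?_ ?_) (Prod.ext ?_ ?_))
        · exact Subtype.ext (map_add PhaseSpace.UV X.1 Y.1)
        · change ρ₁⁻¹ • (k₁ • deriv2 (-L) 0 (⟨X.1.u, X.2.2.1⟩ + ⟨Y.1.u, Y.2.2.1⟩)
            - frakC α • memoryOutput α (X.1.φ₁ + Y.1.φ₁)) = ρ₁⁻¹ • _ + ρ₁⁻¹ • _
          rw [map_add, memoryOutput_add hα _ _ X.2.2.2.2.2.1.1 Y.2.2.2.2.2.1.1]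
          simp only [smul_add, smul_sub]
          abel
        · change ρ₂⁻¹ • (k₂ • deriv2 0 L (⟨X.1.v, X.2.2.2.1⟩ + ⟨Y.1.v, Y.2.2.2.1⟩)
            - frakC α • memoryOutput α (X.1.φ₂ + Y.1.φ₂)) = ρ₂⁻¹ • _ + ρ₂⁻¹ • _
          rw [map_add, memoryOutput_add hα _ _ X.2.2.2.2.2.2.1 Y.2.2.2.2.2.2.1]
          simp only [smul_add, smul_sub]
          abel
        · exact (MemLp.toLp_congr (X + Y).2.2.2.2.2.1.2 (X.2.2.2.2.2.1.2.add Y.2.2.2.2.2.1.2)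
            (memoryRate_add _ _ _ _)).trans (MemLp.toLp_add X.2.2.2.2.2.1.2 Y.2.2.2.2.2.1.2)
        · exact (MemLp.toLp_congr (X + Y).2.2.2.2.2.2.2 (X.2.2.2.2.2.2.2.add Y.2.2.2.2.2.2.2)
            (memoryRate_add _ _ _ _)).trans (MemLp.toLp_add X.2.2.2.2.2.2.2 Y.2.2.2.2.2.2.2)
      map_smul' := by
        intro c X
        refine Prod.ext ?_ (Prod.ext (Prod.ext ?_ ?_) (Prod.ext ?_ ?_))
        · exact Subtype.ext (map_smul PhaseSpace.UV c X.1)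
        · change ρ₁⁻¹ • (k₁ • deriv2 (-L) 0 (c • ⟨X.1.u, X.2.2.1⟩)
            - frakC α • memoryOutput α (c • X.1.φ₁)) = c • (ρ₁⁻¹ • _)
          rw [map_smul, memoryOutput_smul, smul_comm c ρ₁⁻¹, smul_sub c, smul_comm c k₁,
            smul_comm c (frakC α)]
        · change ρ₂⁻¹ • (k₂ • deriv2 0 L (c • ⟨X.1.v, X.2.2.2.1⟩)
            - frakC α • memoryOutput α (c • X.1.φ₂)) = c • (ρ₂⁻¹ • _)
          rw [map_smul, memoryOutput_smul, smul_comm c ρ₂⁻¹, smul_sub c, smul_comm c k₂,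
            smul_comm c (frakC α)]
        · exact (MemLp.toLp_congr (c • X).2.2.2.2.2.1.2 (X.2.2.2.2.2.1.2.const_smul c)
            (memoryRate_smul _ _ _)).trans (MemLp.toLp_const_smul c X.2.2.2.2.2.1.2)
        · exact (MemLp.toLp_congr (c • X).2.2.2.2.2.2.2 (X.2.2.2.2.2.2.2.const_smul c)
            (memoryRate_smul _ _ _)).trans (MemLp.toLp_const_smul c X.2.2.2.2.2.2.2) }

/-! ### Shifted operator and spectrum -/

/-- The operator `z I - T`, defined on the domain of `T`. -/
def shift {H : Type*} [AddCommGroup H] [Module ℂ H] (T : H →ₗ.[ℂ] H) (z : ℂ) :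
    T.domain →ₗ[ℂ] H := z • T.domain.subtype - T.toFun

/-- The spectrum of an unbounded operator `T` in a space with norm `N`: the set of those `z` for
which `z I - T : D(T) → H` is not a bijection with bounded inverse. -/
def opSpectrum {H : Type*} [AddCommGroup H] [Module ℂ H] (N : H → ℝ) (T : H →ₗ.[ℂ] H) : Set ℂ :=
  {z | ¬ (Function.Bijective (shift T z) ∧
    ∃ C : ℝ, ∀ X : T.domain, N (X : H) ≤ C * N (shift T z X))}

end Transmission

end

namespace Transmission

/-! ### Absolutely continuous functions -/

/-! The resolvent equation is reduced to a two-point transmission problem for ordinary differential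
equations. With data `(f, F, h)` on one side of the interface, the first and last lines give `U =
iλu - f` and `φ = (iλ + η + ξ²)⁻¹ (h + μU)`. The symbol `iλ + η + ξ²` is bounded below by a multiple
of `(1 + |ξ|)²` as soon as `η ≠ 0` or `λ ≠ 0`, and `μ / (1 + |ξ|)` is square integrable because `0 <
α < 1`. Hence `∫ μφ = mU + R` with `m = ∫ μ² (iλ + η + ξ²)⁻¹` and `R` controlled by `h`. What
remains is `k u'' = c u + r` with `c = (iλρ + ℭm) iλ`, and likewise for `v`
(`exists_memoryOutput_eq`, `exists_reduced_rhs`).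

Testing with the solution itself makes the interface terms cancel and gives `k₁‖u'‖² + k₂‖v'‖² +
c₁‖u‖² + c₂‖v‖² = -(⟨u, r₁⟩ + ⟨v, r₂⟩)`. The real parts of `c₁, c₂` may be negative, but for `λ ≠ 0`
both have the same nonzero imaginary part `λ ℭ Re m`, since `Re m > 0`: this is the dissipation.
Some `ζ` with `Re ζ = 1` therefore makes both `Re (ζ c_j) ≥ 0` (`exists_rotation`), and for `λ = 0`
both coefficients vanish. With the Poincaré inequality this yields an a priori bound
(`exists_transmission_bound`).

The bound gives injectivity and the estimate on the inverse. It also gives existence: solving from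
each outer endpoint by explicit formulas leaves two unknown slopes and two matching conditions at
`0`, a square linear system that is injective by the bound (`exists_transmission_solution`). -/

/-- Increments of the complex primitive are dominated by those of the primitive of `‖w‖`, which
reduces the claim to real integrands. -/
theorem absolutelyContinuousOnInterval_integral {w : ℝ → ℂ} {a b c : ℝ}
    (h : IntervalIntegrable w volume a b) (hc : c ∈ uIcc a b) :
    AbsolutelyContinuousOnInterval (fun x => ∫ t in c..x, w t) a b := by
  have hsub : ∀ x ∈ uIcc a b, IntervalIntegrable w volume c x := fun x hx =>
    h.mono_set (uIcc_subset_uIcc hc hx)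
  have h1 := h.norm.absolutelyContinuousOnInterval_intervalIntegral hc
  rw [absolutelyContinuousOnInterval_iff] at h1 ⊢
  intro ε hε
  obtain ⟨δ, hδ, H⟩ := h1 ε hε
  refine ⟨δ, hδ, fun E hE hE' => lt_of_le_of_lt (Finset.sum_le_sum fun i hi => ?_) (H E hE hE')⟩
  have hx := hsub _ (hE.1 i hi).1
  have hy := hsub _ (hE.1 i hi).2
  rw [dist_eq_norm, Real.dist_eq, intervalIntegral.integral_interval_sub_left hx hy,
    intervalIntegral.integral_interval_sub_left hx.norm hy.norm]
  exact intervalIntegral.norm_integral_le_abs_integral_norm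

/-- `g` is absolutely continuous on `[a, b]`, with the integrable derivative `w`. -/
structure HasACDeriv (a b : ℝ) (g w : ℝ → ℂ) : Prop where
  integrable : IntervalIntegrable w volume a b
  ac : AbsolutelyContinuousOnInterval g a b
  ae_hasDerivAt : ∀ᵐ x, x ∈ uIcc a b → HasDerivAt g (w x) x

namespace HasACDeriv

variable {a b : ℝ} {g w h z : ℝ → ℂ}

theorem mono {c d : ℝ} (H : HasACDeriv a b g w) (hs : uIcc c d ⊆ uIcc a b) :
    HasACDeriv c d g w where
  integrable := H.integrable.mono_set hs
  ac := H.ac.mono hs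
  ae_hasDerivAt := H.ae_hasDerivAt.mono fun _ hx hm => hx (hs hm)

theorem primitive {c : ℝ} (hw : IntervalIntegrable w volume a b) (hc : c ∈ uIcc a b) :
    HasACDeriv a b (fun x => ∫ t in c..x, w t) w where
  integrable := hw
  ac := absolutelyContinuousOnInterval_integral hw hc
  ae_hasDerivAt := hw.ae_hasDerivAt_integral.mono fun _ hx hm => hx hm c hc

theorem add (H : HasACDeriv a b g w) (K : HasACDeriv a b h z) :
    HasACDeriv a b (fun x => g x + h x) (fun x => w x + z x) where
  integrable := H.integrable.add K.integrable
  ac := H.ac.add K.ac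
  ae_hasDerivAt := by
    filter_upwards [H.ae_hasDerivAt, K.ae_hasDerivAt] with x hx kx hm using (hx hm).add (kx hm)

theorem mul (H : HasACDeriv a b g w) (K : HasACDeriv a b h z) :
    HasACDeriv a b (fun x => g x * h x) (fun x => w x * h x + g x * z x) where
  integrable := (H.integrable.mul_continuousOn K.ac.continuousOn).add
    (K.integrable.continuousOn_mul H.ac.continuousOn)
  ac := H.ac.smul K.ac
  ae_hasDerivAt := by
    filter_upwards [H.ae_hasDerivAt, K.ae_hasDerivAt] with x hx kx hm using (hx hm).mul (kx hm)

theorem of_hasDerivAt (hg : ∀ x, HasDerivAt g (w x) x) (hw : Continuous w) :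
    HasACDeriv a b g w where
  integrable := hw.intervalIntegrable a b
  ac := by
    have hd : deriv g = w := funext fun x => (hg x).deriv
    have : ContDiff ℝ 1 g := contDiff_one_iff_deriv.2
      ⟨fun x => (hg x).differentiableAt, hd ▸ hw⟩
    exact this.contDiffOn.absolutelyContinuousOnInterval
  ae_hasDerivAt := Filter.Eventually.of_forall fun x _ => hg x

theorem const (c : ℂ) : HasACDeriv a b (fun _ => c) (fun _ => 0) :=
  of_hasDerivAt (fun x => hasDerivAt_const x c) continuous_const

theorem const_mul (H : HasACDeriv a b g w) (c : ℂ) :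
    HasACDeriv a b (fun x => c * g x) (fun x => c * w x) := by
  simpa using (const c).mul H

theorem star (H : HasACDeriv a b g w) :
    HasACDeriv a b (fun x => star (g x)) (fun x => star (w x)) where
  integrable := by
    have := H.integrable
    rw [intervalIntegrable_iff] at this ⊢
    exact (Complex.conjCLE : ℂ →L[ℝ] ℂ).integrable_comp this
  ac := by
    have h1 := H.ac
    rw [absolutelyContinuousOnInterval_iff] at h1 ⊢
    simpa only [dist_star_star] using h1
  ae_hasDerivAt := by
    filter_upwards [H.ae_hasDerivAt] with x hx hm using (hx hm).star

theorem congr (H : HasACDeriv a b g w) (hw : w =ᵐ[volume.restrict (uIoc a b)] z) :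
    HasACDeriv a b g z where
  integrable := H.integrable.congr_ae hw
  ac := H.ac
  ae_hasDerivAt := by
    -- The hypothesis concerns the half-open interval, the derivative condition the closed one; they
    -- differ by one null point.
    have h1 : ∀ᵐ x ∂volume, x ≠ min a b := by simp [ae_iff]
    filter_upwards [H.ae_hasDerivAt, (ae_restrict_iff' measurableSet_uIoc).1 hw, h1] with x hx kx hn hm
    rw [← kx ⟨lt_of_le_of_ne hm.1 (Ne.symm hn), hm.2⟩]
    exact hx hm

/-- The difference between `g` and the primitive of `w` is absolutely continuous with zero
derivative almost everywhere, hence constant. -/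
theorem integral_eq (H : HasACDeriv a b g w) : ∫ x in a..b, w x = g b - g a := by
  have h1 := (primitive H.integrable (left_mem_uIcc (a := a) (b := b)))
  have h2 : AbsolutelyContinuousOnInterval (g - fun x => ∫ t in a..x, w t) a b := H.ac.sub h1.ac
  obtain ⟨C, hC⟩ := h2.const_of_ae_hasDerivAt_zero (by
    filter_upwards [H.ae_hasDerivAt, h1.ae_hasDerivAt] with x hx kx hm
    simpa using (hx hm).sub (kx hm))
  have ha := hC a left_mem_uIcc
  have hb := hC b right_mem_uIcc
  simp only [Pi.sub_apply, intervalIntegral.integral_same, sub_zero] at ha hb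
  rw [ha, ← hb]
  ring

theorem integral_parts (H : HasACDeriv a b g w) (K : HasACDeriv a b h z) :
    (∫ x in a..b, w x * h x) + ∫ x in a..b, g x * z x = g b * h b - g a * h a := by
  rw [← intervalIntegral.integral_add (H.integrable.mul_continuousOn K.ac.continuousOn)
    (K.integrable.continuousOn_mul H.ac.continuousOn)]
  exact (H.mul K).integral_eq

end HasACDeriv

/-! ### Weak derivatives and absolutely continuous representatives -/

section Rep

variable {a b : ℝ}

theorem L2.intervalIntegrable (hab : a < b) (u : L2 a b) : IntervalIntegrable u volume a b := by
  rw [intervalIntegrable_iff, uIoc_of_le hab.le, integrableOn_Ioc_iff_integrableOn_Ioo]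
  exact (Lp.memLp u).integrable one_le_two

theorem ae_uIoc_of_ae_Ioo (hab : a < b) {f g : ℝ → ℂ} (h : f =ᵐ[volume.restrict (Ioo a b)] g) :
    f =ᵐ[volume.restrict (uIoc a b)] g := by
  rwa [uIoc_of_le hab.le, ← Measure.restrict_congr_set Ioo_ae_eq_Ioc]

theorem integral_Ioo_eq_interval (hab : a < b) (f : ℝ → ℂ) :
    ∫ x in Ioo a b, f x = ∫ x in a..b, f x := by
  rw [intervalIntegral.integral_of_le hab.le, integral_Ioc_eq_integral_Ioo]

theorem hasACDeriv_ofReal {φ : ℝ → ℝ} (hφ : ContDiff ℝ ∞ φ) :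
    HasACDeriv a b (fun x => (φ x : ℂ)) (fun x => ((deriv φ x : ℝ) : ℂ)) :=
  .of_hasDerivAt (fun x => ((hφ.differentiable (by norm_num)).differentiableAt
    (x := x)).hasDerivAt.ofReal_comp)
    (Complex.continuous_ofReal.comp (hφ.continuous_deriv (by norm_num)))

theorem test_endpoints {φ : ℝ → ℝ} (hs : tsupport φ ⊆ Ioo a b) : φ a = 0 ∧ φ b = 0 :=
  ⟨image_eq_zero_of_notMem_tsupport fun h => lt_irrefl _ (hs h).1,
    image_eq_zero_of_notMem_tsupport fun h => lt_irrefl _ (hs h).2⟩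

theorem HasACDeriv.hasWeakDeriv (hab : a < b) {u w : L2 a b} {g : ℝ → ℂ}
    (hg : HasACDeriv a b g w) (hu : u =ᵐ[volume.restrict (Ioo a b)] g) : HasWeakDeriv u w := by
  intro φ hφ _ hs
  have h1 := (hasACDeriv_ofReal (a := a) (b := b) hφ).integral_parts hg
  rw [(test_endpoints hs).1, (test_endpoints hs).2] at h1
  have e1 : ∫ x in Ioo a b, deriv φ x • u x = ∫ x in a..b, ((deriv φ x : ℝ) : ℂ) * g x := by
    rw [← integral_Ioo_eq_interval hab]
    refine integral_congr_ae ?_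
    filter_upwards [hu] with x hx
    rw [hx, Complex.real_smul]
  have e2 : ∫ x in Ioo a b, φ x • w x = ∫ x in a..b, (φ x : ℂ) * w x := by
    rw [← integral_Ioo_eq_interval hab]
    simp only [Complex.real_smul]
  rw [e1, e2, eq_neg_iff_add_eq_zero, h1]
  simp

/-- The primitive from `a` vanishes to the left of the support, and to its right because the mean is
zero. -/
theorem exists_test_antideriv (hab : a < b) {χ : ℝ → ℝ} (hχ : ContDiff ℝ ∞ χ) (hc : HasCompactSupport χ)
    (hs : tsupport χ ⊆ Ioo a b) (h0 : ∫ x in a..b, χ x = 0) :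
    ∃ φ : ℝ → ℝ, ContDiff ℝ ∞ φ ∧ HasCompactSupport φ ∧ tsupport φ ⊆ Ioo a b ∧ deriv φ = χ := by
  have hd : ∀ x, HasDerivAt (fun x => ∫ t in a..x, χ t) (χ x) x := fun x =>
    intervalIntegral.integral_hasDerivAt_right (hχ.continuous.intervalIntegrable _ _)
      (hχ.continuous.stronglyMeasurableAtFilter _ _) hχ.continuous.continuousAt
  have hde : deriv (fun x => ∫ t in a..x, χ t) = χ := funext fun x => (hd x).deriv
  obtain ⟨c, d, hcd⟩ : ∃ c d, tsupport χ ⊆ Icc c d ∧ a < c ∧ d < b := by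
    rcases (tsupport χ).eq_empty_or_nonempty with he | hne
    -- For `χ = 0` the reversed endpoints satisfy the strict inequalities and make `Icc c d` empty.
    · exact ⟨b, a, by simp [he], hab, hab⟩
    · obtain ⟨c, hcm, hcl⟩ := hc.isCompact.exists_isLeast hne
      obtain ⟨d, hdm, hdl⟩ := hc.isCompact.exists_isGreatest hne
      exact ⟨c, d, fun x hx => ⟨hcl hx, hdl hx⟩, (hs hcm).1, (hs hdm).2⟩
  have hz : ∀ x, x ∉ Icc c d → χ x = 0 := fun x hx =>
    image_eq_zero_of_notMem_tsupport fun h => hx (hcd.1 h)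
  have hsupp : ∀ x, x ∉ Icc c d → ∫ t in a..x, χ t = 0 := by
    intro x hx
    by_cases hxc : x < c
    · rw [intervalIntegral.integral_congr (g := fun _ => (0 : ℝ)), intervalIntegral.integral_zero]
      exact fun t ht => hz t fun hm =>
        (max_lt hcd.2.1 hxc).not_ge (hm.1.trans ht.2)
    · have hxd : d < x := by
        by_contra hn
        exact hx ⟨not_lt.1 hxc, not_lt.1 hn⟩
      have h1 : ∫ t in x..b, χ t = 0 := by
        rw [intervalIntegral.integral_congr (g := fun _ => (0 : ℝ)), intervalIntegral.integral_zero]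
        exact fun t ht => hz t fun hm => (lt_min hxd hcd.2.2).not_ge (ht.1.trans hm.2)
      rw [← intervalIntegral.integral_add_adjacent_intervals
        (hχ.continuous.intervalIntegrable a x) (hχ.continuous.intervalIntegrable x b), h1,
        add_zero] at h0
      exact h0
  have hts : tsupport (fun x => ∫ t in a..x, χ t) ⊆ Icc c d :=
    closure_minimal (fun x hx => by
      by_contra hn
      exact hx (hsupp x hn)) isClosed_Icc
  refine ⟨fun x => ∫ t in a..x, χ t, ?_, ?_, hts.trans (Icc_subset_Ioo hcd.2.1 hcd.2.2), hde⟩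
  · rw [contDiff_infty_iff_deriv, hde]
    exact ⟨fun x => (hd x).differentiableAt, hχ⟩
  · exact HasCompactSupport.of_support_subset_isCompact isCompact_Icc (subset_closure.trans hts)

theorem exists_unit_test (hab : a < b) : ∃ ψ : ℝ → ℝ, ContDiff ℝ ∞ ψ ∧ HasCompactSupport ψ ∧
    tsupport ψ ⊆ Ioo a b ∧ ∫ x in a..b, ψ x = 1 := by
  have hr : (0 : ℝ) < (b - a) / 4 := by linarith
  let f : ContDiffBump ((a + b) / 2) := ⟨(b - a) / 8, (b - a) / 4, by linarith, by linarith⟩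
  have hs : tsupport (f.normed volume) ⊆ Ioo a b := by
    rw [f.tsupport_normed_eq, Real.closedBall_eq_Icc]
    intro x hx
    change x ∈ Icc ((a + b) / 2 - (b - a) / 4) ((a + b) / 2 + (b - a) / 4) at hx
    exact ⟨by linarith [hx.1], by linarith [hx.2]⟩
  refine ⟨f.normed volume, f.contDiff_normed, f.hasCompactSupport_normed, hs, ?_⟩
  rw [intervalIntegral.integral_of_le hab.le, ← f.integral_normed (μ := volume)]
  refine setIntegral_eq_integral_of_forall_compl_eq_zero fun x hx => ?_
  exact image_eq_zero_of_notMem_tsupport fun h => hx (Ioo_subset_Ioc_self (hs h))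

/-- Du Bois-Reymond: a test function minus its mean times a fixed `ψ` of integral one is the
derivative of a test function. So `d` acts on every test function as the constant `∫ ψ d` does. -/
theorem ae_const_of_weakDeriv_zero (hab : a < b) {d : ℝ → ℂ}
    (hd : IntegrableOn d (Ioo a b))
    (h : ∀ φ : ℝ → ℝ, ContDiff ℝ ∞ φ → HasCompactSupport φ → tsupport φ ⊆ Ioo a b →
      ∫ x in Ioo a b, deriv φ x • d x = 0) :
    ∃ c : ℂ, d =ᵐ[volume.restrict (Ioo a b)] fun _ => c := by
  obtain ⟨ψ, hψ, hψc, hψs, hψ1⟩ := exists_unit_test hab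
  have hint : ∀ χ : ℝ → ℝ, ContDiff ℝ ∞ χ → HasCompactSupport χ →
      IntegrableOn (fun x => χ x • d x) (Ioo a b) := fun χ h1 h2 =>
    hd.locallyIntegrable.integrable_smul_left_of_hasCompactSupport h1.continuous h2
  refine ⟨∫ x in Ioo a b, ψ x • d x, ?_⟩
  have key : ∀ᵐ x ∂(volume.restrict (Ioo a b)), x ∈ Ioo a b →
      d x - ∫ x in Ioo a b, ψ x • d x = 0 := by
    have hdc : IntegrableOn (fun x => d x - ∫ x in Ioo a b, ψ x • d x) (Ioo a b) :=
      hd.sub (integrableOn_const (by simp))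
    refine isOpen_Ioo.ae_eq_zero_of_integral_contDiff_smul_eq_zero
      (hdc.locallyIntegrable.locallyIntegrableOn _) fun χ hχ hχc hχs => ?_
    set m : ℝ := ∫ x in a..b, χ x with hm
    obtain ⟨φ, h1, h2, h3, h4⟩ := exists_test_antideriv hab
      (χ := fun x => χ x - m * ψ x) (hχ.sub (contDiff_const.mul hψ))
      (hχc.sub (hψc.mul_left (f := fun _ => m)))
      ((tsupport_sub _ _).trans (union_subset hχs ((tsupport_mul_subset_right
        (f := fun _ => m)).trans hψs)))
      (by
        rw [intervalIntegral.integral_sub (hχ.continuous.intervalIntegrable _ _)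
          ((hψ.continuous.intervalIntegrable _ _).const_mul m),
          intervalIntegral.integral_const_mul, hψ1, ← hm]
        ring)
    have h5 := h φ h1 h2 h3
    rw [h4] at h5
    have e1 : ∫ x in Ioo a b, (χ x - m * ψ x) • d x =
        (∫ x in Ioo a b, χ x • d x) - m • ∫ x in Ioo a b, ψ x • d x := by
      rw [← integral_smul, ← integral_sub (hint χ hχ hχc) ((hint ψ hψ hψc).fun_smul m)]
      simp only [sub_smul, mul_smul]
    rw [e1] at h5
    simp only [smul_sub]
    rw [integral_sub (hint χ hχ hχc) (((hχ.continuous.integrable_of_hasCompactSupport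
      hχc).integrableOn).smul_const _), integral_smul_const]
    rwa [hm, intervalIntegral.integral_of_le hab.le, integral_Ioc_eq_integral_Ioo] at h5
  filter_upwards [key, ae_restrict_mem measurableSet_Ioo] with x hx hm
  exact sub_eq_zero.1 (hx hm)

/-- Subtracting the primitive of `w` from `u` leaves a function with zero weak derivative, which is
a constant. -/
theorem HasWeakDeriv.exists_rep (hab : a < b) {u w : L2 a b} (h : HasWeakDeriv u w) :
    ∃ g : ℝ → ℂ, HasACDeriv a b g w ∧ u =ᵐ[volume.restrict (Ioo a b)] g := by
  have hp := HasACDeriv.primitive (w.intervalIntegrable hab) (left_mem_uIcc (a := a) (b := b))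
  have hc : ContinuousOn (fun x => ∫ t in a..x, w t) (Icc a b) := by
    simpa [uIcc_of_le hab.le] using hp.ac.continuousOn
  have hpi : IntegrableOn (fun x => ∫ t in a..x, w t) (Ioo a b) :=
    (hc.integrableOn_compact isCompact_Icc).mono_set Ioo_subset_Icc_self
  have hui : IntegrableOn u (Ioo a b) := (Lp.memLp u).integrable one_le_two
  obtain ⟨c, hcc⟩ := ae_const_of_weakDeriv_zero hab (d := fun x => u x - ∫ t in a..x, w t)
    (hui.sub hpi) (by
      intro φ hφ hφc hs
      have hd : Continuous (deriv φ) := hφ.continuous_deriv (by norm_num)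
      have h1 := (hasACDeriv_ofReal (a := a) (b := b) hφ).integral_parts hp
      rw [(test_endpoints hs).1, (test_endpoints hs).2, ← integral_Ioo_eq_interval hab,
        ← integral_Ioo_eq_interval hab, Complex.ofReal_zero, zero_mul, zero_mul] at h1
      have h2 := h φ hφ hφc hs
      simp only [smul_sub]
      rw [integral_sub (integrable_test u hd hφc.deriv)
        (hpi.locallyIntegrable.integrable_smul_left_of_hasCompactSupport hd hφc.deriv), h2]
      simp only [Complex.real_smul]
      linear_combination -h1)
  refine ⟨fun x => c + ∫ t in a..x, w t, by simpa using (HasACDeriv.const c).add hp, ?_⟩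
  filter_upwards [hcc] with x hx
  rw [← hx]
  ring

end Rep

/-! ### Boundary values, integration by parts and the Poincaré inequality -/

section Values

variable {a b : ℝ}

theorem HasACDeriv.continuousOn {g w : ℝ → ℂ} (hab : a < b) (hg : HasACDeriv a b g w) :
    ContinuousOn g (Icc a b) := by
  simpa [uIcc_of_le hab.le] using hg.ac.continuousOn

/-- Continuous functions that agree almost everywhere inside the interval agree up to its endpoints,
so boundary values can be read off any continuous representative. -/
theorem HasValue.eq_of_rep (hab : a < b) {u : L2 a b} {g : ℝ → ℂ} (hg : ContinuousOn g (Icc a b))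
    (hu : u =ᵐ[volume.restrict (Ioo a b)] g) {p : ℝ} (hp : p ∈ Icc a b) {c : ℂ}
    (h : HasValue u p c) : g p = c := by
  obtain ⟨k, hk, huk, rfl⟩ := h
  have h1 : g =ᵐ[volume.restrict (Icc a b)] k := by
    rw [← Measure.restrict_congr_set Ioo_ae_eq_Icc]
    exact hu.symm.trans huk
  exact Measure.eqOn_Icc_of_ae_eq volume hab.ne h1 hg hk hp

theorem HasValue.unique (hab : a < b) {u : L2 a b} {p : ℝ} (hp : p ∈ Icc a b) {c d : ℂ}
    (h : HasValue u p c) (h' : HasValue u p d) : c = d := by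
  obtain ⟨k, hk, huk, rfl⟩ := h
  exact h'.eq_of_rep hab hk huk hp

theorem HasWeakDeriv.exists_hasValue (hab : a < b) {u w : L2 a b} (h : HasWeakDeriv u w) (p : ℝ) :
    ∃ c, HasValue u p c := by
  obtain ⟨g, hg, hu⟩ := h.exists_rep hab
  exact ⟨g p, g, hg.continuousOn hab, hu, rfl⟩

theorem HasWeakDeriv.inner_parts (hab : a < b) {u w y z : L2 a b} (h : HasWeakDeriv u w)
    (k : HasWeakDeriv y z) {ua ub ya yb : ℂ} (hua : HasValue u a ua) (hub : HasValue u b ub)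
    (hya : HasValue y a ya) (hyb : HasValue y b yb) :
    inner ℂ u z + inner ℂ w y = star ub * yb - star ua * ya := by
  obtain ⟨g, hg, hu⟩ := h.exists_rep hab
  obtain ⟨f, hf, hy⟩ := k.exists_rep hab
  have ha : a ∈ Icc a b := left_mem_Icc.2 hab.le
  have hb : b ∈ Icc a b := right_mem_Icc.2 hab.le
  have h1 := hg.star.integral_parts hf
  rw [← integral_Ioo_eq_interval hab, ← integral_Ioo_eq_interval hab] at h1
  rw [← hua.eq_of_rep hab (hg.continuousOn hab) hu ha,
    ← hub.eq_of_rep hab (hg.continuousOn hab) hu hb,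
    ← hya.eq_of_rep hab (hf.continuousOn hab) hy ha,
    ← hyb.eq_of_rep hab (hf.continuousOn hab) hy hb, ← h1, add_comm,
    MeasureTheory.L2.inner_def, MeasureTheory.L2.inner_def]
  congr 1
  · refine integral_congr_ae ?_
    filter_upwards [hy] with x hx
    rw [RCLike.inner_apply, hx, mul_comm]
    rfl
  · refine integral_congr_ae ?_
    filter_upwards [hu] with x hx
    rw [RCLike.inner_apply, hx, mul_comm]
    rfl

/-- Cauchy–Schwarz for a scalar weight against a vector-valued function. It serves both the Poincaré
inequality and the memory integral. -/
theorem integral_norm_smul_le {X E : Type*} [MeasurableSpace X] {ν : Measure X}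
    [NormedAddCommGroup E] [NormedSpace ℂ E] {g : X → ℂ} (hg : MemLp g 2 ν) (h : Lp E 2 ν) :
    Integrable (fun x => g x • h x) ν ∧
      ∫ x, ‖g x • h x‖ ∂ν ≤ (eLpNorm g 2 ν).toReal * ‖h‖ := by
  have h1 : MemLp (fun x => g x • h x) 1 ν := (Lp.memLp h).smul hg
  refine ⟨memLp_one_iff_integrable.1 h1, ?_⟩
  rw [integral_norm_eq_lintegral_enorm h1.1, ← eLpNorm_one_eq_lintegral_enorm, Lp.norm_def,
    ← ENNReal.toReal_mul]
  exact ENNReal.toReal_mono (ENNReal.mul_ne_top hg.2.ne (Lp.memLp h).2.ne)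
    (eLpNorm_smul_le_mul_eLpNorm (p := 2) (q := 2) (r := 1) (Lp.memLp h).1 hg.1)

/-- Integrating from the zero at `p` bounds `u` pointwise by the `L¹` norm of `w`, hence by its `L²`
norm. -/
theorem exists_poincare (hab : a < b) : ∃ K : ℝ, 0 ≤ K ∧ ∀ (u w : L2 a b) (p : ℝ), p ∈ Icc a b →
    HasWeakDeriv u w → HasValue u p 0 → ‖u‖ ≤ K * ‖w‖ := by
  have h1 : MemLp (fun _ : ℝ => (1 : ℂ)) 2 (volume.restrict (Ioo a b)) := memLp_const 1
  set K₀ := (eLpNorm (fun _ : ℝ => (1 : ℂ)) 2 (volume.restrict (Ioo a b))).toReal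
  set V : ℝ := ((volume.restrict (Ioo a b)).real univ) ^ (ENNReal.toReal 2)⁻¹ with hV
  have hK₀ : 0 ≤ K₀ := ENNReal.toReal_nonneg
  refine ⟨V * K₀, by positivity, fun u w p hp h hv => ?_⟩
  obtain ⟨g, hg, hu⟩ := h.exists_rep hab
  have h0 := hv.eq_of_rep hab (hg.continuousOn hab) hu hp
  obtain ⟨h2, h3⟩ := integral_norm_smul_le h1 w
  simp only [one_smul] at h2 h3
  have hb : ∀ᵐ x ∂(volume.restrict (Ioo a b)), ‖u x‖ ≤ K₀ * ‖w‖ := by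
    filter_upwards [hu, ae_restrict_mem measurableSet_Ioo] with x hx hm
    have h4 := (hg.mono (c := p) (d := x) (by
      rw [uIcc_of_le hab.le]
      exact uIcc_subset_Icc hp (Ioo_subset_Icc_self hm))).integral_eq
    rw [h0, sub_zero] at h4
    rw [hx, ← h4]
    refine (intervalIntegral.norm_integral_le_integral_norm_uIoc).trans (le_trans ?_ h3)
    rw [← integral_Ioc_eq_integral_Ioo]
    refine setIntegral_mono_set ((integrableOn_Ioc_iff_integrableOn_Ioo).2 h2.norm)
      (Filter.Eventually.of_forall fun _ => norm_nonneg _) (LE.le.eventuallyLE ?_)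
    exact Ioc_subset_Ioc (le_min hp.1 hm.1.le) (max_le hp.2 hm.2.le)
  rw [mul_assoc]
  exact Lp.norm_le_of_ae_bound (by positivity) hb

end Values

/-! ### The transmission problem -/

/-- `(u, v) ∈ H² × H²` satisfies the boundary and transmission conditions; `w, z` are the first and
`w', z'` the second derivatives. -/
structure IsTransmissionPair (L : ℝ) (k₁ k₂ : ℂ) (u w w' : L2 (-L) 0) (v z z' : L2 0 L) : Prop where
  du : HasWeakDeriv u w
  dw : HasWeakDeriv w w'
  dv : HasWeakDeriv v z
  dz : HasWeakDeriv z z'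
  left : HasValue u (-L) 0
  right : HasValue v L 0
  cont : ∃ c, HasValue u 0 c ∧ HasValue v 0 c
  flux : ∃ p q, HasValue w 0 p ∧ HasValue z 0 q ∧ k₁ * p = k₂ * q

/-- Integration by parts on each side: the outer boundary terms vanish, and those at `0` add up to
`star c * (k₁ * p - k₂ * q) = 0`. -/
theorem IsTransmissionPair.energy {L : ℝ} (hL : 0 < L) {k₁ k₂ c₁ c₂ : ℂ} {u w w' : L2 (-L) 0}
    {v z z' : L2 0 L} (h : IsTransmissionPair L k₁ k₂ u w w' v z z') {r₁ : L2 (-L) 0} {r₂ : L2 0 L}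
    (e₁ : k₁ • w' = c₁ • u + r₁) (e₂ : k₂ • z' = c₂ • v + r₂) :
    k₁ * (‖w‖ ^ 2 : ℝ) + k₂ * (‖z‖ ^ 2 : ℝ) + c₁ * (‖u‖ ^ 2 : ℝ) + c₂ * (‖v‖ ^ 2 : ℝ) =
      -(inner ℂ u r₁ + inner ℂ v r₂) := by
  obtain ⟨c, hc1, hc2⟩ := h.cont
  obtain ⟨p, q, hp, hq, hpq⟩ := h.flux
  have hL' : -L < 0 := by linarith
  obtain ⟨s, hs⟩ := h.dw.exists_hasValue hL' (-L)
  obtain ⟨t, ht⟩ := h.dz.exists_hasValue hL L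
  have i1 := h.du.inner_parts hL' h.dw h.left hc1 hs hp
  have i2 := h.dv.inner_parts hL h.dz hc2 h.right hq ht
  rw [inner_self_eq_norm_sq_to_K] at i1 i2
  have j1 : k₁ * inner ℂ u w' = c₁ * (‖u‖ ^ 2 : ℝ) + inner ℂ u r₁ := by
    rw [← inner_smul_right, e₁, inner_add_right, inner_smul_right, inner_self_eq_norm_sq_to_K]
    push_cast
    rfl
  have j2 : k₂ * inner ℂ v z' = c₂ * (‖v‖ ^ 2 : ℝ) + inner ℂ v r₂ := by
    rw [← inner_smul_right, e₂, inner_add_right, inner_smul_right, inner_self_eq_norm_sq_to_K]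
    push_cast
    rfl
  simp only [star_zero, zero_mul, sub_zero, zero_sub, Complex.coe_algebraMap] at i1 i2
  push_cast at j1 j2 ⊢
  linear_combination k₁ * i1 + k₂ * i2 - j1 - j2 + star c * hpq

/-- Take the real part of `ζ` times the energy identity: the zeroth-order terms are nonnegative and
can be dropped, and the Poincaré inequality turns the right side into derivatives times data. -/
theorem exists_transmission_bound {L k₁ k₂ : ℝ} (hL : 0 < L) (hk₁ : 0 < k₁) (hk₂ : 0 < k₂)
    {c₁ c₂ ζ : ℂ} (hζ : ζ.re = 1) (h₁ : 0 ≤ (ζ * c₁).re) (h₂ : 0 ≤ (ζ * c₂).re) :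
    ∃ K : ℝ, 0 ≤ K ∧ ∀ (u w w' : L2 (-L) 0) (v z z' : L2 0 L) (r₁ : L2 (-L) 0) (r₂ : L2 0 L),
      IsTransmissionPair L k₁ k₂ u w w' v z z' → (k₁ : ℂ) • w' = c₁ • u + r₁ →
      (k₂ : ℂ) • z' = c₂ • v + r₂ → ‖w‖ + ‖z‖ ≤ K * (‖r₁‖ + ‖r₂‖) := by
  have hL' : -L < 0 := by linarith
  obtain ⟨K₁, hK₁, P₁⟩ := exists_poincare hL'
  obtain ⟨K₂, hK₂, P₂⟩ := exists_poincare hL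
  set m := min k₁ k₂
  have hm : 0 < m := lt_min hk₁ hk₂
  set B := ‖ζ‖ * (K₁ + K₂) with hB
  have hB0 : 0 ≤ B := by positivity
  refine ⟨2 * B / m, by positivity, fun u w w' v z z' r₁ r₂ h e₁ e₂ => ?_⟩
  have E := congrArg (fun t => (ζ * t).re) (h.energy hL e₁ e₂)
  have b1 := P₁ u w (-L) (left_mem_Icc.2 hL'.le) h.du h.left
  have b2 := P₂ v z L (right_mem_Icc.2 hL.le) h.dv h.right
  have E1 : (ζ * (k₁ * (‖w‖ ^ 2 : ℝ) + k₂ * (‖z‖ ^ 2 : ℝ) + c₁ * (‖u‖ ^ 2 : ℝ)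
      + c₂ * (‖v‖ ^ 2 : ℝ))).re = k₁ * ‖w‖ ^ 2 + k₂ * ‖z‖ ^ 2 + (ζ * c₁).re * ‖u‖ ^ 2
        + (ζ * c₂).re * ‖v‖ ^ 2 := by
    simp only [mul_add, ← mul_assoc, Complex.add_re, Complex.re_mul_ofReal, hζ, one_mul]
  have E2 : (ζ * -(inner ℂ u r₁ + inner ℂ v r₂)).re ≤ ‖ζ‖ * (‖u‖ * ‖r₁‖ + ‖v‖ * ‖r₂‖) := by
    refine (Complex.re_le_norm _).trans ?_
    rw [norm_mul, norm_neg]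
    gcongr
    exact (norm_add_le _ _).trans (add_le_add (norm_inner_le_norm _ _) (norm_inner_le_norm _ _))
  have E3 : m * (‖w‖ ^ 2 + ‖z‖ ^ 2) ≤ B * ((‖w‖ + ‖z‖) * (‖r₁‖ + ‖r₂‖)) := by
    have e1 : m * (‖w‖ ^ 2 + ‖z‖ ^ 2) ≤ k₁ * ‖w‖ ^ 2 + k₂ * ‖z‖ ^ 2 := by
      rw [mul_add]
      gcongr
      · exact min_le_left _ _
      · exact min_le_right _ _
    have e2 : ‖u‖ * ‖r₁‖ + ‖v‖ * ‖r₂‖ ≤ (K₁ + K₂) * ((‖w‖ + ‖z‖) * (‖r₁‖ + ‖r₂‖)) := by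
      have f1 : ‖u‖ ≤ (K₁ + K₂) * (‖w‖ + ‖z‖) := b1.trans (by gcongr <;> linarith [norm_nonneg z])
      have f2 : ‖v‖ ≤ (K₁ + K₂) * (‖w‖ + ‖z‖) := b2.trans (by gcongr <;> linarith [norm_nonneg w])
      calc _ ≤ (K₁ + K₂) * (‖w‖ + ‖z‖) * ‖r₁‖ + (K₁ + K₂) * (‖w‖ + ‖z‖) * ‖r₂‖ := by gcongr
        _ = _ := by ring
    have e3 := mul_le_mul_of_nonneg_left e2 (norm_nonneg ζ)
    have e4 := mul_nonneg h₁ (sq_nonneg ‖u‖)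
    have e5 := mul_nonneg h₂ (sq_nonneg ‖v‖)
    simp only [E1] at E
    rw [hB, mul_assoc]
    linarith
  rw [div_mul_eq_mul_div, le_div_iff₀ hm]
  set s := ‖w‖ + ‖z‖ with hs
  have hs0 : 0 ≤ s := by positivity
  -- This is the source of the factor `2` in the constant. One factor `s` is cancelled below, the
  -- case `s = 0` apart.
  have E4 : s ^ 2 ≤ 2 * (‖w‖ ^ 2 + ‖z‖ ^ 2) := by
    rw [hs]; nlinarith [sq_nonneg (‖w‖ - ‖z‖)]
  have E5 : s * (s * m) ≤ s * (2 * B * (‖r₁‖ + ‖r₂‖)) := by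
    have := mul_le_mul_of_nonneg_left E4 hm.le
    nlinarith
  rcases hs0.eq_or_lt with h0 | h0
  · rw [← h0, zero_mul]; positivity
  · exact le_of_mul_le_mul_left E5 h0

/-! ### Solvability of the transmission problem -/

/-- With `s² = σ` these are `sinh (s x) / s` and `cosh (s x)`, or their limits `x` and `1` when `s =
0`. The last identity is the Wronskian. -/
theorem exists_fundamental_system (σ : ℂ) : ∃ S C : ℝ → ℂ, (∀ x, HasDerivAt S (C x) x) ∧
    (∀ x, HasDerivAt C (σ * S x) x) ∧ S 0 = 0 ∧ C 0 = 1 ∧ ∀ x, C x ^ 2 - σ * S x ^ 2 = 1 := by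
  obtain ⟨s, rfl⟩ : ∃ s, σ = s ^ 2 := ⟨_, (Complex.cpow_nat_inv_pow σ two_ne_zero).symm⟩
  rcases eq_or_ne s 0 with rfl | hs
  · refine ⟨fun x => x, fun _ => 1, fun x => Complex.ofRealCLM.hasDerivAt, fun x => ?_, by simp, rfl,
      by simp⟩
    simpa using hasDerivAt_const x (1 : ℂ)
  · have hl : ∀ x : ℝ, HasDerivAt (fun x : ℝ => s * (x : ℂ)) s x := fun x => by
      simpa using (Complex.ofRealCLM.hasDerivAt (x := x)).const_mul s
    refine ⟨fun x => Complex.sinh (s * x) / s, fun x => Complex.cosh (s * x), fun x => ?_,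
      fun x => ?_, by simp, by simp, fun x => ?_⟩
    · exact (((Complex.hasDerivAt_sinh _).comp x (hl x)).div_const s).congr_deriv
        (mul_div_cancel_right₀ _ hs)
    · exact ((Complex.hasDerivAt_cosh _).comp x (hl x)).congr_deriv (by field_simp)
    · have := Complex.cosh_sq_sub_sinh_sq (s * x)
      field_simp
      exact this

/-! ### One-sided solutions of `u'' = σ u + r`. -/

section OneSided

variable {a b : ℝ}

theorem exists_L2_of_hasACDeriv (hab : a < b) {g h : ℝ → ℂ} {σ : ℂ} {r : L2 a b}
    (hg : HasACDeriv a b g h) (hh : HasACDeriv a b h fun x => σ * g x + r x) :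
    ∃ u w : L2 a b, HasWeakDeriv u w ∧ HasWeakDeriv w (σ • u + r) ∧
      ∀ p, HasValue u p (g p) ∧ HasValue w p (h p) := by
  have key : ∀ f : ℝ → ℂ, ContinuousOn f (Icc a b) → MemLp f 2 (volume.restrict (Ioo a b)) :=
    fun f hf => by
      obtain ⟨K, hK⟩ := isCompact_Icc.exists_bound_of_continuousOn hf
      refine MemLp.of_bound ((hf.mono Ioo_subset_Icc_self).aestronglyMeasurable measurableSet_Ioo)
        K ?_
      filter_upwards [ae_restrict_mem measurableSet_Ioo] with x hx
      exact hK x (Ioo_subset_Icc_self hx)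
  have mg := key g (hg.continuousOn hab)
  have mh := key h (hh.continuousOn hab)
  refine ⟨mg.toLp g, mh.toLp h, ?_, ?_, fun p =>
    ⟨⟨g, hg.continuousOn hab, mg.coeFn_toLp, rfl⟩, ⟨h, hh.continuousOn hab, mh.coeFn_toLp, rfl⟩⟩⟩
  · exact (hg.congr (ae_uIoc_of_ae_Ioo hab mh.coeFn_toLp.symm)).hasWeakDeriv hab mg.coeFn_toLp
  · refine (hh.congr (ae_uIoc_of_ae_Ioo hab ?_)).hasWeakDeriv hab mh.coeFn_toLp
    filter_upwards [Lp.coeFn_add (σ • mg.toLp g) r, Lp.coeFn_smul σ (mg.toLp g), mg.coeFn_toLp]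
      with x h1 h2 h3
    rw [h1, Pi.add_apply, h2, Pi.smul_apply, h3, smul_eq_mul]

theorem exists_homogeneous_solution (hab : a < b) (σ : ℂ) (p : ℝ) :
    ∃ u w : L2 a b, HasWeakDeriv u w ∧ HasWeakDeriv w (σ • u) ∧
      HasValue u p 0 ∧ HasValue w p 1 := by
  obtain ⟨S, C, hS, hC, hS0, hC0, -⟩ := exists_fundamental_system σ
  have cS : Continuous S := continuous_iff_continuousAt.2 fun x => (hS x).continuousAt
  have cC : Continuous C := continuous_iff_continuousAt.2 fun x => (hC x).continuousAt
  have h1 : HasACDeriv a b (fun x => S (x - p)) (fun x => C (x - p)) :=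
    .of_hasDerivAt (fun x => (hS (x - p)).comp_sub_const x p)
      (cC.comp (continuous_id.sub continuous_const))
  have h2 : HasACDeriv a b (fun x => C (x - p)) (fun x => σ * S (x - p)) :=
    .of_hasDerivAt (fun x => (hC (x - p)).comp_sub_const x p)
      (continuous_const.mul (cS.comp (continuous_id.sub continuous_const)))
  obtain ⟨u, w, hu, hw, hv⟩ := exists_L2_of_hasACDeriv hab (σ := σ) (r := 0) h1 (h2.congr (by
    refine ae_uIoc_of_ae_Ioo hab ?_
    filter_upwards [Lp.coeFn_zero ℂ 2 (volume.restrict (Ioo a b))] with x hx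
    rw [hx]
    simp))
  refine ⟨u, w, hu, by simpa using hw, ?_, ?_⟩
  · simpa [hS0] using (hv p).1
  · simpa [hC0] using (hv p).2

/-- Variation of constants, `u = S ∫ C r - C ∫ S r` with integrals starting at `p`; the Wronskian
identity gives `r` the coefficient one in the second derivative. -/
theorem exists_particular_solution (hab : a < b) (σ : ℂ) (r : L2 a b) {p : ℝ} (hp : p ∈ Icc a b) :
    ∃ u w : L2 a b, HasWeakDeriv u w ∧ HasWeakDeriv w (σ • u + r) ∧ HasValue u p 0 := by
  obtain ⟨S, C, hS, hC, -, -, hW⟩ := exists_fundamental_system σ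
  have cS : Continuous S := continuous_iff_continuousAt.2 fun x => (hS x).continuousAt
  have cC : Continuous C := continuous_iff_continuousAt.2 fun x => (hC x).continuousAt
  have aS : HasACDeriv a b S C := .of_hasDerivAt hS cC
  have aC : HasACDeriv a b C (fun x => σ * S x) := .of_hasDerivAt hC (continuous_const.mul cS)
  have hp' : p ∈ uIcc a b := by rwa [uIcc_of_le hab.le]
  have ri := r.intervalIntegrable hab
  have aI := HasACDeriv.primitive (ri.continuousOn_mul cC.continuousOn) hp'
  have aJ := HasACDeriv.primitive (ri.continuousOn_mul cS.continuousOn) hp'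
  have h1 : HasACDeriv a b
      (fun x => S x * (∫ t in p..x, C t * r t) + (-1) * (C x * ∫ t in p..x, S t * r t))
      (fun x => C x * (∫ t in p..x, C t * r t) + (-1) * (σ * (S x * ∫ t in p..x, S t * r t))) :=
    ((aS.mul aI).add ((aC.mul aJ).const_mul (-1))).congr
      (Filter.Eventually.of_forall fun x => by ring)
  have h2 : HasACDeriv a b
      (fun x => C x * (∫ t in p..x, C t * r t) + (-1) * (σ * (S x * ∫ t in p..x, S t * r t)))
      (fun x => σ * (S x * (∫ t in p..x, C t * r t) + (-1) * (C x * ∫ t in p..x, S t * r t))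
        + r x) :=
    ((aC.mul aI).add (((aS.mul aJ).const_mul σ).const_mul (-1))).congr
      (Filter.Eventually.of_forall fun x => by linear_combination r x * hW x)
  obtain ⟨u, w, hu, hw, hv⟩ := exists_L2_of_hasACDeriv hab h1 h2
  exact ⟨u, w, hu, hw, by simpa using (hv p).1⟩

end OneSided

theorem HasValue.of_zero {a b : ℝ} (hab : a < b) {p : ℝ} (hp : p ∈ Icc a b) {c : ℂ}
    (h : HasValue (0 : L2 a b) p c) : c = 0 :=
  h.unique hab hp HasValue.zero

/-- Shooting from the outer endpoints: each side is a particular solution plus a multiple of the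
homogeneous one, and the multiples `A`, `B` must match values and fluxes at `0`. -/
theorem exists_transmission_solution {L k₁ k₂ : ℝ} (hL : 0 < L) (hk₁ : 0 < k₁) (hk₂ : 0 < k₂)
    {c₁ c₂ ζ : ℂ} (hζ : ζ.re = 1) (h₁ : 0 ≤ (ζ * c₁).re) (h₂ : 0 ≤ (ζ * c₂).re)
    (r₁ : L2 (-L) 0) (r₂ : L2 0 L) : ∃ (u w w' : L2 (-L) 0) (v z z' : L2 0 L),
      IsTransmissionPair L k₁ k₂ u w w' v z z' ∧ (k₁ : ℂ) • w' = c₁ • u + r₁ ∧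
      (k₂ : ℂ) • z' = c₂ • v + r₂ := by
  have hL' : -L < 0 := by linarith
  have n₁ : (k₁ : ℂ) ≠ 0 := Complex.ofReal_ne_zero.2 hk₁.ne'
  have n₂ : (k₂ : ℂ) ≠ 0 := Complex.ofReal_ne_zero.2 hk₂.ne'
  have ml : -L ∈ Icc (-L) 0 := left_mem_Icc.2 hL'.le
  have mr : L ∈ Icc 0 L := right_mem_Icc.2 hL.le
  obtain ⟨u₁, w₁, du₁, dw₁, vu₁, vw₁⟩ := exists_homogeneous_solution hL' (c₁ / k₁) (-L)
  obtain ⟨v₁, z₁, dv₁, dz₁, vv₁, vz₁⟩ := exists_homogeneous_solution hL (c₂ / k₂) L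
  obtain ⟨u₀, w₀, du₀, dw₀, vu₀⟩ := exists_particular_solution hL' (c₁ / k₁) ((k₁ : ℂ)⁻¹ • r₁) ml
  obtain ⟨v₀, z₀, dv₀, dz₀, vv₀⟩ := exists_particular_solution hL (c₂ / k₂) ((k₂ : ℂ)⁻¹ • r₂) mr
  obtain ⟨a₁, ha₁⟩ := du₁.exists_hasValue hL' 0
  obtain ⟨a₀, ha₀⟩ := du₀.exists_hasValue hL' 0
  obtain ⟨b₁, hb₁⟩ := dv₁.exists_hasValue hL 0
  obtain ⟨b₀, hb₀⟩ := dv₀.exists_hasValue hL 0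
  obtain ⟨p₁, hp₁⟩ := dw₁.exists_hasValue hL' 0
  obtain ⟨p₀, hp₀⟩ := dw₀.exists_hasValue hL' 0
  obtain ⟨q₁, hq₁⟩ := dz₁.exists_hasValue hL 0
  obtain ⟨q₀, hq₀⟩ := dz₀.exists_hasValue hL 0
  let T : ℂ × ℂ →ₗ[ℂ] ℂ × ℂ :=
    { toFun := fun x => (x.1 * a₁ - x.2 * b₁, k₁ * (x.1 * p₁) - k₂ * (x.2 * q₁))
      map_add' := fun x y => by
        simp only [Prod.fst_add, Prod.snd_add, Prod.mk_add_mk]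
        congr 1 <;> ring
      map_smul' := fun c x => by
        simp only [Prod.smul_fst, Prod.smul_snd, Prod.smul_mk, smul_eq_mul, RingHom.id_apply]
        congr 1 <;> ring }
  have hT : Function.Injective T := by
    rw [injective_iff_map_eq_zero]
    rintro ⟨A, B⟩ h0
    obtain ⟨t1, t2⟩ := Prod.mk.inj h0
    obtain ⟨K, -, hK⟩ := exists_transmission_bound hL hk₁ hk₂ hζ h₁ h₂
    -- A kernel vector of `T` is a transmission pair with zero data. The a priori bound kills its
    -- derivatives, whose values at the outer endpoints are `A` and `B`.
    have hP : IsTransmissionPair L k₁ k₂ (A • u₁) (A • w₁) (A • (c₁ / k₁) • u₁)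
        (B • v₁) (B • z₁) (B • (c₂ / k₂) • v₁) :=
      { du := du₁.smul A
        dw := dw₁.smul A
        dv := dv₁.smul B
        dz := dz₁.smul B
        left := by simpa using vu₁.smul A
        right := by simpa using vv₁.smul B
        cont := ⟨A * a₁, ha₁.smul A, sub_eq_zero.1 t1 ▸ hb₁.smul B⟩
        flux := ⟨A * p₁, B * q₁, hp₁.smul A, hq₁.smul B, sub_eq_zero.1 t2⟩ }
    have h3 := hK _ _ _ _ _ _ 0 0 hP
      (by simp only [smul_smul, add_zero]; congr 1; field_simp)
      (by simp only [smul_smul, add_zero]; congr 1; field_simp)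
    rw [norm_zero, norm_zero, add_zero, mul_zero] at h3
    have hA : A • w₁ = 0 := norm_le_zero_iff.1 (by linarith [norm_nonneg (B • z₁)])
    have hB : B • z₁ = 0 := norm_le_zero_iff.1 (by linarith [norm_nonneg (A • w₁)])
    have hA' := (hA ▸ vw₁.smul A).of_zero hL' ml
    have hB' := (hB ▸ vz₁.smul B).of_zero hL mr
    rw [mul_one] at hA' hB'
    rw [hA', hB']
    rfl
  -- The target is the mismatch of the particular solutions at `0`, in value and in flux.
  obtain ⟨⟨A, B⟩, hAB⟩ := LinearMap.injective_iff_surjective.1 hT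
    (b₀ - a₀, k₂ * q₀ - k₁ * p₀)
  obtain ⟨t1, t2⟩ := Prod.mk.inj hAB
  refine ⟨u₀ + A • u₁, w₀ + A • w₁, _, v₀ + B • v₁, z₀ + B • z₁, _,
    { du := du₀.add (du₁.smul A)
      dw := dw₀.add (dw₁.smul A)
      dv := dv₀.add (dv₁.smul B)
      dz := dz₀.add (dz₁.smul B)
      left := by simpa using vu₀.add (vu₁.smul A)
      right := by simpa using vv₀.add (vv₁.smul B)
      cont := ⟨a₀ + A * a₁, ha₀.add (ha₁.smul A), ?_⟩
      flux := ⟨p₀ + A * p₁, q₀ + B * q₁, hp₀.add (hp₁.smul A), hq₀.add (hq₁.smul B), ?_⟩ }, ?_, ?_⟩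
  · have : a₀ + A * a₁ = b₀ + B * b₁ := by linear_combination t1
    rw [this]
    exact hb₀.add (hb₁.smul B)
  · linear_combination t2
  · simp only [smul_add, smul_smul, mul_inv_cancel₀ n₁, one_smul, mul_div_cancel₀ _ n₁,
      mul_left_comm (k₁ : ℂ) A, mul_comm A c₁]
    abel
  · simp only [smul_add, smul_smul, mul_inv_cancel₀ n₂, one_smul, mul_div_cancel₀ _ n₂,
      mul_left_comm (k₂ : ℂ) B, mul_comm B c₂]
    abel

/-! ### The memory variables -/

/-- The multiplier `(i lam + η + |ξ|²)⁻¹` of the resolvent of the memory equation. -/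
noncomputable def resolventWeight (η lam ξ : ℝ) : ℂ :=
  (Complex.I * lam + ((|ξ| ^ 2 + η : ℝ) : ℂ))⁻¹

theorem measurable_mu (α : ℝ) : Measurable (mu α) := by unfold mu; fun_prop

theorem mu_nonneg (α ξ : ℝ) : 0 ≤ mu α ξ := Real.rpow_nonneg (abs_nonneg ξ) _

theorem measurable_resolventWeight (η lam : ℝ) : Measurable (resolventWeight η lam) := by
  unfold resolventWeight; fun_prop

/-! ### Estimates on the multiplier and its integral. -/

section Weight

variable {η lam : ℝ}

theorem exists_symbol_bound (hη : 0 ≤ η) (hne : η ≠ 0 ∨ lam ≠ 0) : ∃ δ : ℝ, 0 < δ ∧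
    ∀ ξ : ℝ, δ * (1 + |ξ|) ^ 2 ≤ ‖Complex.I * lam + ((|ξ| ^ 2 + η : ℝ) : ℂ)‖ := by
  have hs : 0 < η + |lam| := by
    rcases hne with h | h
    · have := lt_of_le_of_ne hη h.symm; positivity
    · have := abs_pos.2 h; positivity
  -- One factor `1/2` comes from bounding real plus imaginary part by twice the norm, the other from
  -- `(1 + |ξ|)² ≤ 2 (1 + |ξ|²)`.
  refine ⟨min (η + |lam|) 1 / 4, by positivity, fun ξ => ?_⟩
  have h1 := Complex.abs_re_le_norm (Complex.I * lam + ((|ξ| ^ 2 + η : ℝ) : ℂ))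
  have h2 := Complex.abs_im_le_norm (Complex.I * lam + ((|ξ| ^ 2 + η : ℝ) : ℂ))
  simp only [Complex.add_re, Complex.mul_re, Complex.I_re, Complex.I_im, Complex.ofReal_re,
    Complex.ofReal_im, Complex.add_im, Complex.mul_im, zero_mul, one_mul, mul_zero, sub_zero,
    zero_add, add_zero] at h1 h2
  rw [abs_of_nonneg (by positivity)] at h1
  have h3 : min (η + |lam|) 1 ≤ η + |lam| := min_le_left _ _
  have h4 : min (η + |lam|) 1 * |ξ| ^ 2 ≤ |ξ| ^ 2 :=
    mul_le_of_le_one_left (sq_nonneg _) (min_le_right _ _)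
  have h5 : 0 ≤ min (η + |lam|) 1 * (1 - |ξ|) ^ 2 := by positivity
  nlinarith

theorem symbol_ne_zero (hη : 0 ≤ η) (hne : η ≠ 0 ∨ lam ≠ 0) (ξ : ℝ) :
    Complex.I * lam + ((|ξ| ^ 2 + η : ℝ) : ℂ) ≠ 0 := by
  obtain ⟨δ, hδ, h⟩ := exists_symbol_bound hη hne
  exact norm_pos_iff.1 (lt_of_lt_of_le (by positivity) (h ξ))

theorem exists_resolventWeight_bound (hη : 0 ≤ η) (hne : η ≠ 0 ∨ lam ≠ 0) : ∃ K : ℝ, 0 ≤ K ∧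
    ∀ ξ : ℝ, (1 + |ξ|) ^ 2 * ‖resolventWeight η lam ξ‖ ≤ K := by
  obtain ⟨δ, hδ, h⟩ := exists_symbol_bound hη hne
  refine ⟨δ⁻¹, by positivity, fun ξ => ?_⟩
  have hp : 0 < δ * (1 + |ξ|) ^ 2 := by positivity
  rw [resolventWeight, norm_inv, ← div_eq_mul_inv, div_le_iff₀ (hp.trans_le (h ξ)),
    inv_mul_eq_div, le_div_iff₀ hδ, mul_comm]
  exact h ξ

/-- The multiplier decays like `(1 + |ξ|)⁻²`, so one factor `1 + |ξ|` can be spent on `f` and `μ /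
(1 + |ξ|)` remains. It is used with `f` equal to `1`, `|ξ|` and `1 + |ξ|`. -/
theorem memLp_abs_mu_resolventWeight {α : ℝ} (hα : α ∈ Ioo (0 : ℝ) 1) (hη : 0 ≤ η)
    (hne : η ≠ 0 ∨ lam ≠ 0) {f : ℝ → ℝ} (hf : Measurable f) (hf1 : ∀ ξ, |f ξ| ≤ 1 + |ξ|) :
    MemLp (fun ξ => ((f ξ * mu α ξ : ℝ) : ℂ) * resolventWeight η lam ξ) 2 volume := by
  obtain ⟨K, hK, h⟩ := exists_resolventWeight_bound hη hne
  refine (memLp_weight hα).of_le_mul (c := K) ((Complex.measurable_ofReal.comp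
    (hf.mul (measurable_mu α))).mul (measurable_resolventWeight η lam)).aestronglyMeasurable
    (Filter.Eventually.of_forall fun ξ => ?_)
  have hp : 0 < 1 + |ξ| := by positivity
  rw [norm_mul, Complex.norm_real, Real.norm_eq_abs, Real.norm_eq_abs, abs_mul, abs_div,
    abs_of_pos hp, abs_of_nonneg (mu_nonneg α ξ), ← mul_div_assoc, le_div_iff₀ hp]
  calc |f ξ| * mu α ξ * ‖resolventWeight η lam ξ‖ * (1 + |ξ|)
      ≤ (1 + |ξ|) * mu α ξ * ‖resolventWeight η lam ξ‖ * (1 + |ξ|) := by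
        gcongr
        · exact mu_nonneg α ξ
        · exact hf1 ξ
    _ = (1 + |ξ|) ^ 2 * ‖resolventWeight η lam ξ‖ * mu α ξ := by ring
    _ ≤ K * mu α ξ := by
        gcongr
        · exact mu_nonneg α ξ
        · exact h ξ

theorem memLp_mu_resolventWeight {α : ℝ} (hα : α ∈ Ioo (0 : ℝ) 1) (hη : 0 ≤ η)
    (hne : η ≠ 0 ∨ lam ≠ 0) :
    MemLp (fun ξ => (mu α ξ : ℂ) * resolventWeight η lam ξ) 2 volume := by
  simpa using memLp_abs_mu_resolventWeight hα hη hne (f := fun _ => 1) measurable_const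
    (fun ξ => by simp)

theorem integrable_mu_sq_resolventWeight {α : ℝ} (hα : α ∈ Ioo (0 : ℝ) 1) (hη : 0 ≤ η)
    (hne : η ≠ 0 ∨ lam ≠ 0) :
    Integrable (fun ξ => (mu α ξ : ℂ) * ((mu α ξ : ℂ) * resolventWeight η lam ξ)) := by
  have h1 := (memLp_abs_mu_resolventWeight hα hη hne (lam := lam) (f := fun ξ => 1 + |ξ|)
    (by fun_prop) (fun ξ => (abs_of_nonneg (by positivity)).le))
  have h2 := (memLp_weight hα).ofReal (K := ℂ)
  refine (h2.integrable_mul h1).congr (Filter.Eventually.of_forall fun ξ => ?_)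
  have hp : (1 + ((|ξ| : ℝ) : ℂ)) ≠ 0 := by
    have : (1 + |ξ|) ≠ 0 := by positivity
    exact_mod_cast this
  simp only [Pi.mul_apply, Complex.coe_algebraMap, Complex.ofReal_div, Complex.ofReal_mul,
    Complex.ofReal_add, Complex.ofReal_one]
  field_simp

/-- The number `∫ μ(ξ)² (i lam + η + |ξ|²)⁻¹ dξ`. -/
noncomputable def memoryConst (α η lam : ℝ) : ℂ :=
  ∫ ξ : ℝ, (mu α ξ : ℂ) * ((mu α ξ : ℂ) * resolventWeight η lam ξ)

/-- The real part of the integrand is `μ² (ξ² + η) / |iλ + η + ξ²|²`, nonnegative everywhere and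
positive on the half-line `ξ > 0`. -/
theorem memoryConst_re_pos {α : ℝ} (hα : α ∈ Ioo (0 : ℝ) 1) (hη : 0 ≤ η)
    (hne : η ≠ 0 ∨ lam ≠ 0) : 0 < (memoryConst α η lam).re := by
  have hi := integrable_mu_sq_resolventWeight hα hη hne (lam := lam)
  have he : (memoryConst α η lam).re =
      ∫ ξ : ℝ, ((mu α ξ : ℂ) * ((mu α ξ : ℂ) * resolventWeight η lam ξ)).re :=
    (integral_re hi).symm
  have hre : ∀ ξ : ℝ, ((mu α ξ : ℂ) * ((mu α ξ : ℂ) * resolventWeight η lam ξ)).re =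
      mu α ξ ^ 2 * ((|ξ| ^ 2 + η) /
        Complex.normSq (Complex.I * lam + ((|ξ| ^ 2 + η : ℝ) : ℂ))) := by
    intro ξ
    rw [Complex.re_ofReal_mul, Complex.re_ofReal_mul, resolventWeight, Complex.inv_re]
    simp only [Complex.add_re, Complex.mul_re, Complex.I_re, Complex.I_im, Complex.ofReal_re,
      Complex.ofReal_im, zero_mul, sub_zero, zero_add, mul_zero]
    ring
  rw [he]
  refine (integral_pos_iff_support_of_nonneg (fun ξ => ?_) hi.re).2 ?_
  · change 0 ≤ ((mu α ξ : ℂ) * ((mu α ξ : ℂ) * resolventWeight η lam ξ)).re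
    rw [hre]
    have := Complex.normSq_nonneg (Complex.I * lam + ((|ξ| ^ 2 + η : ℝ) : ℂ))
    positivity
  · refine lt_of_lt_of_le (by simp : (0 : ℝ≥0∞) < volume (Ioi (0 : ℝ)))
      (measure_mono fun ξ (hξ : 0 < ξ) => ?_)
    have h1 : 0 < mu α ξ := Real.rpow_pos_of_pos (abs_pos.2 hξ.ne') _
    have h2 := Complex.normSq_pos.2 (symbol_ne_zero hη hne ξ)
    have h3 : 0 < |ξ| := abs_pos.2 hξ.ne'
    refine ne_of_gt ?_
    change 0 < ((mu α ξ : ℂ) * ((mu α ξ : ℂ) * resolventWeight η lam ξ)).re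
    rw [hre]
    positivity

end Weight

/-! ### Solution of the memory equation. -/

section Memory

variable {a b α η lam : ℝ}

theorem L2.real_smul_eq (r : ℝ) (x : L2 a b) : r • x = (r : ℂ) • x :=
  RCLike.real_smul_eq_coe_smul r x

theorem memory_pointwise_iff (hη : 0 ≤ η) (hne : η ≠ 0 ∨ lam ≠ 0) (ξ : ℝ) (x y W : L2 a b) :
    (-(|ξ| ^ 2 + η)) • x + mu α ξ • W = (Complex.I * lam) • x - y ↔
      x = resolventWeight η lam ξ • y + ((mu α ξ : ℂ) * resolventWeight η lam ξ) • W := by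
  have hd := symbol_ne_zero hη hne (lam := lam) ξ
  rw [L2.real_smul_eq, L2.real_smul_eq, mul_comm (mu α ξ : ℂ) (resolventWeight η lam ξ),
    mul_smul (resolventWeight η lam ξ), ← smul_add, resolventWeight, eq_inv_smul_iff₀ hd,
    add_smul, Complex.ofReal_neg, neg_smul]
  constructor
  · intro h
    rw [← sub_eq_zero] at h ⊢
    rw [← neg_eq_zero, ← h]
    abel
  · intro h
    rw [← sub_eq_zero] at h ⊢
    rw [← neg_eq_zero, ← h]
    abel

/-- `φ = (i lam + η + |ξ|²)⁻¹ (h + μ W)`. -/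
def IsMemorySolution (α η lam : ℝ) (φ h : LL2 a b) (W : L2 a b) : Prop :=
  φ =ᵐ[volume] fun ξ => resolventWeight η lam ξ • h ξ
    + ((mu α ξ : ℂ) * resolventWeight η lam ξ) • W

theorem isMemorySolution_iff (hη : 0 ≤ η) (hne : η ≠ 0 ∨ lam ≠ 0) {φ h : LL2 a b} {W : L2 a b} :
    IsMemorySolution α η lam φ h W ↔
      memoryRate α η φ W =ᵐ[volume] fun ξ => (Complex.I * lam) • φ ξ - h ξ :=
  Filter.eventually_congr (Filter.Eventually.of_forall fun ξ =>
    (memory_pointwise_iff hη hne ξ (φ ξ) (h ξ) W).symm)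

theorem MemLp.smul_const_right {g : ℝ → ℂ} (hg : MemLp g 2 volume) (W : L2 a b) :
    MemLp (fun ξ => g ξ • W) 2 volume :=
  hg.of_le_mul (c := ‖W‖) (hg.1.smul_const W)
    (Filter.Eventually.of_forall fun ξ => by rw [norm_smul, mul_comm])

theorem memLp_bounded_smul {g : ℝ → ℂ} (hg : Measurable g) {K : ℝ} (hK : ∀ ξ, ‖g ξ‖ ≤ K)
    (h : LL2 a b) : MemLp (fun ξ => g ξ • h ξ) 2 volume :=
  (Lp.memLp h).of_le_mul (c := K) (hg.aestronglyMeasurable.smul (Lp.memLp h).1)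
    (Filter.Eventually.of_forall fun ξ => by
      rw [norm_smul]
      exact mul_le_mul_of_nonneg_right (hK ξ) (norm_nonneg _))

theorem exists_isMemorySolution_bound (hα : α ∈ Ioo (0 : ℝ) 1) (hη : 0 ≤ η)
    (hne : η ≠ 0 ∨ lam ≠ 0) : ∃ K : ℝ, 0 ≤ K ∧ ∀ (h : LL2 a b) (W : L2 a b),
      ∃ φ : LL2 a b, IsMemorySolution α η lam φ h W ∧ ‖φ‖ ≤ K * (‖h‖ + ‖W‖) := by
  obtain ⟨K, hK, hw⟩ := exists_resolventWeight_bound hη hne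
  have hw' : ∀ ξ, ‖resolventWeight η lam ξ‖ ≤ K := fun ξ => by
    refine le_trans ?_ (hw ξ)
    exact le_mul_of_one_le_left (norm_nonneg _) (by nlinarith [abs_nonneg ξ])
  have mw := memLp_mu_resolventWeight hα hη hne (lam := lam)
  refine ⟨K + ‖mw.toLp _‖, by positivity, fun h W => ?_⟩
  have m1 := memLp_bounded_smul (measurable_resolventWeight η lam) hw' h
  have m2 := MemLp.smul_const_right mw W
  refine ⟨m1.toLp _ + m2.toLp _, ?_, ?_⟩
  · filter_upwards [Lp.coeFn_add (m1.toLp _) (m2.toLp _), m1.coeFn_toLp, m2.coeFn_toLp]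
      with ξ e1 e2 e3
    rw [e1, Pi.add_apply, e2, e3]
  · have b1 : ‖m1.toLp _‖ ≤ K * ‖h‖ := by
      refine Lp.norm_le_mul_norm_of_ae_le_mul ?_
      filter_upwards [m1.coeFn_toLp] with ξ e
      rw [e, norm_smul]
      exact mul_le_mul_of_nonneg_right (hw' ξ) (norm_nonneg _)
    have b2 : ‖m2.toLp _‖ ≤ ‖W‖ * ‖mw.toLp _‖ := by
      refine Lp.norm_le_mul_norm_of_ae_le_mul ?_
      filter_upwards [m2.coeFn_toLp, mw.coeFn_toLp] with ξ e e'
      rw [e, e', norm_smul, mul_comm]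
    have b3 := mul_nonneg (norm_nonneg (mw.toLp _)) (norm_nonneg h)
    have b4 := mul_nonneg hK (norm_nonneg W)
    calc _ ≤ ‖m1.toLp _‖ + ‖m2.toLp _‖ := norm_add_le _ _
      _ ≤ K * ‖h‖ + ‖W‖ * ‖mw.toLp _‖ := add_le_add b1 b2
      _ ≤ _ := by linarith

theorem IsMemorySolution.unique {φ ψ h : LL2 a b} {W : L2 a b}
    (H : IsMemorySolution α η lam φ h W) (H' : IsMemorySolution α η lam ψ h W) : φ = ψ :=
  Lp.ext (H.trans H'.symm)

/-- The multiplier absorbs the factor `|ξ|` in both terms of `φ`, while the memory rate equals `iλφ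
- h` by the equation and needs no estimate. -/
theorem IsMemorySolution.memoryCond (hα : α ∈ Ioo (0 : ℝ) 1) (hη : 0 ≤ η)
    (hne : η ≠ 0 ∨ lam ≠ 0) {φ h : LL2 a b} {W : L2 a b} (H : IsMemorySolution α η lam φ h W) :
    MemoryCond α η φ W := by
  constructor
  · obtain ⟨K, hK, hw⟩ := exists_resolventWeight_bound hη hne
    have m1 := memLp_bounded_smul (g := fun ξ => ((|ξ| : ℝ) : ℂ) * resolventWeight η lam ξ) (K := K)
      ((Complex.measurable_ofReal.comp measurable_id.abs).mul (measurable_resolventWeight η lam))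
      (fun ξ => by
        rw [norm_mul, Complex.norm_real, Real.norm_eq_abs, abs_abs]
        refine le_trans ?_ (hw ξ)
        gcongr
        nlinarith [abs_nonneg ξ]) h
    have m2 := MemLp.smul_const_right (memLp_abs_mu_resolventWeight hα hη hne (lam := lam)
      (f := fun ξ => |ξ|) measurable_id.abs (fun ξ => by simp)) W
    refine (m1.add m2).ae_eq ?_
    filter_upwards [H] with ξ hξ
    rw [Pi.add_apply, hξ, L2.real_smul_eq, smul_add, smul_smul, smul_smul]
    simp only [Complex.ofReal_mul, mul_assoc]
  · refine MemLp.ae_eq ((isMemorySolution_iff hη hne).1 H).symm ?_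
    exact ((Lp.memLp φ).const_smul (Complex.I * lam)).sub (Lp.memLp h)

/-- The remainder `R` is the integral of `μ` times the multiplier against `h`; it does not depend on
`W`, so the memory acts on the velocity as a complex scalar. -/
theorem exists_memoryOutput_eq (hα : α ∈ Ioo (0 : ℝ) 1) (hη : 0 ≤ η) (hne : η ≠ 0 ∨ lam ≠ 0) :
    ∃ K : ℝ, 0 ≤ K ∧ ∀ h : LL2 a b, ∃ R : L2 a b, ‖R‖ ≤ K * ‖h‖ ∧
      ∀ (φ : LL2 a b) (W : L2 a b), IsMemorySolution α η lam φ h W →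
        memoryOutput α φ = memoryConst α η lam • W + R := by
  have mw := memLp_mu_resolventWeight hα hη hne (lam := lam)
  refine ⟨(eLpNorm (fun ξ => (mu α ξ : ℂ) * resolventWeight η lam ξ) 2
    (volume : Measure ℝ)).toReal, ENNReal.toReal_nonneg, fun h => ?_⟩
  obtain ⟨i1, n1⟩ := integral_norm_smul_le mw h
  refine ⟨_, (norm_integral_le_integral_norm _).trans n1, fun φ W H => ?_⟩
  have i2 := integrable_mu_sq_resolventWeight hα hη hne (lam := lam)
  rw [memoryConst, ← integral_smul_const, ← integral_add (i2.smul_const W) i1]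
  refine integral_congr_ae ?_
  filter_upwards [H] with ξ hξ
  rw [hξ, L2.real_smul_eq, smul_add, smul_smul, smul_smul, add_comm]

end Memory

/-! ### Reduction of the resolvent equation to the transmission problem -/

theorem weakDeriv_spec {a b : ℝ} (u : H1 a b) : HasWeakDeriv u.1 (weakDeriv a b u) :=
  u.2.choose_spec

/-- `weakDeriv` is defined by choice; uniqueness identifies it with any weak derivative at hand. -/
theorem weakDeriv_eq {a b : ℝ} {u : H1 a b} {w : L2 a b} (h : HasWeakDeriv u.1 w) :
    weakDeriv a b u = w :=
  (weakDeriv_spec u).unique h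

theorem deriv2_spec {a b : ℝ} (u : H2 a b) : HasWeakDeriv (weakDeriv a b u.1) (deriv2 a b u) :=
  weakDeriv_spec (deriv1 a b u)

theorem deriv2_eq {a b : ℝ} {u : H2 a b} {w w' : L2 a b} (h : HasWeakDeriv u.1.1 w)
    (h' : HasWeakDeriv w w') : deriv2 a b u = w' := by
  refine (deriv2_spec u).unique ?_
  rwa [weakDeriv_eq h]

/-- The zeroth-order coefficient of the reduced equation for the displacement. -/
noncomputable def reducedCoeff (ρ α η lam : ℝ) : ℂ :=
  (Complex.I * lam * ρ + frakC α * memoryConst α η lam) * (Complex.I * lam)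

theorem frakC_pos {α : ℝ} (hα : α ∈ Ioo (0 : ℝ) 1) : 0 < frakC α :=
  mul_pos (inv_pos.2 Real.pi_pos) (Real.sin_pos_of_pos_of_lt_pi
    (mul_pos hα.1 Real.pi_pos) (by nlinarith [Real.pi_pos, hα.2]))

/-- The density enters only the real part of the coefficient, so both have the same imaginary part
`s ≠ 0` when `λ ≠ 0`. With `ζ = 1 - i (|x₁| + |x₂|) / s` the real parts become `x_j + |x₁| + |x₂|`.
-/
theorem exists_rotation {ρ₁ ρ₂ α η lam : ℝ} (hα : α ∈ Ioo (0 : ℝ) 1) (hη : 0 ≤ η)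
    (hne : η ≠ 0 ∨ lam ≠ 0) : ∃ ζ : ℂ, ζ.re = 1 ∧ 0 ≤ (ζ * reducedCoeff ρ₁ α η lam).re ∧
      0 ≤ (ζ * reducedCoeff ρ₂ α η lam).re := by
  rcases eq_or_ne lam 0 with rfl | hl
  · exact ⟨1, by simp [reducedCoeff]⟩
  · set s := lam * (frakC α * (memoryConst α η lam).re) with hs
    have hs0 : s ≠ 0 :=
      mul_ne_zero hl (mul_pos (frakC_pos hα) (memoryConst_re_pos hα hη hne)).ne'
    have him : ∀ ρ : ℝ, (reducedCoeff ρ α η lam).im = s := fun ρ => by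
      simp [reducedCoeff, hs]
      ring
    set x₁ := (reducedCoeff ρ₁ α η lam).re
    set x₂ := (reducedCoeff ρ₂ α η lam).re
    refine ⟨⟨1, -((|x₁| + |x₂|) / s)⟩, rfl, ?_, ?_⟩
    · rw [Complex.mul_re, him, neg_mul, div_mul_cancel₀ _ hs0]
      change 0 ≤ 1 * x₁ - -(|x₁| + |x₂|)
      linarith [neg_abs_le x₁, abs_nonneg x₂]
    · rw [Complex.mul_re, him, neg_mul, div_mul_cancel₀ _ hs0]
      change 0 ≤ 1 * x₂ - -(|x₁| + |x₂|)
      linarith [neg_abs_le x₂, abs_nonneg x₁]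

/-- Here `r = ℭR - ρF - d f` depends on the data alone. The equivalence is used forwards for the
resolvent bound and backwards for existence. -/
theorem exists_reduced_rhs {a b ρ k α η lam : ℝ} (hρ : 0 < ρ) (hα : α ∈ Ioo (0 : ℝ) 1)
    (hη : 0 ≤ η) (hne : η ≠ 0 ∨ lam ≠ 0) : ∃ K : ℝ, 0 ≤ K ∧
      ∀ (f F : L2 a b) (h : LL2 a b), ∃ r : L2 a b, ‖r‖ ≤ K * (‖f‖ + ‖F‖ + ‖h‖) ∧
        ∀ (u u₂ : L2 a b) (φ : LL2 a b),
          IsMemorySolution α η lam φ h ((Complex.I * lam) • u - f) →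
          ((Complex.I * lam) • ((Complex.I * lam) • u - f)
            - ρ⁻¹ • (k • u₂ - frakC α • memoryOutput α φ) = F ↔
              (k : ℂ) • u₂ = reducedCoeff ρ α η lam • u + r) := by
  obtain ⟨K, hK, H⟩ := exists_memoryOutput_eq (a := a) (b := b) hα hη hne (lam := lam)
  set d : ℂ := Complex.I * lam * ρ + frakC α * memoryConst α η lam with hd
  have hC := (frakC_pos hα).le
  refine ⟨‖d‖ + ρ + frakC α * K, by positivity, fun f F h => ?_⟩
  obtain ⟨R, hR, HR⟩ := H h
  refine ⟨(frakC α : ℂ) • R - (ρ : ℂ) • F - d • f, ?_, fun u u₂ φ hφ => ?_⟩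
  · have h1 : ‖(frakC α : ℂ) • R‖ ≤ frakC α * (K * ‖h‖) := by
      rw [norm_smul, Complex.norm_of_nonneg hC]
      gcongr
    have h2 : ‖(ρ : ℂ) • F‖ = ρ * ‖F‖ := by rw [norm_smul, Complex.norm_of_nonneg hρ.le]
    have h3 : ‖d • f‖ = ‖d‖ * ‖f‖ := norm_smul _ _
    have h4 := norm_sub_le ((frakC α : ℂ) • R - (ρ : ℂ) • F) (d • f)
    have h5 := norm_sub_le ((frakC α : ℂ) • R) ((ρ : ℂ) • F)
    have p1 : 0 ≤ frakC α * K := by positivity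
    have e : (‖d‖ + ρ + frakC α * K) * (‖f‖ + ‖F‖ + ‖h‖) - (frakC α * (K * ‖h‖) + ρ * ‖F‖
        + ‖d‖ * ‖f‖) = ‖d‖ * (‖F‖ + ‖h‖) + ρ * (‖f‖ + ‖h‖) + frakC α * K * (‖f‖ + ‖F‖) := by ring
    have p : 0 ≤ ‖d‖ * (‖F‖ + ‖h‖) + ρ * (‖f‖ + ‖h‖) + frakC α * K * (‖f‖ + ‖F‖) := by positivity
    linarith
  · have hρ' : (ρ : ℂ) ≠ 0 := Complex.ofReal_ne_zero.2 hρ.ne'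
    rw [HR φ _ hφ, L2.real_smul_eq, L2.real_smul_eq, L2.real_smul_eq, Complex.ofReal_inv,
      sub_eq_iff_eq_add, add_comm, ← sub_eq_iff_eq_add, eq_comm, inv_smul_eq_iff₀ hρ',
      sub_eq_iff_eq_add]
    refine Eq.congr_right ?_
    rw [reducedCoeff, hd]
    module

/-! ### Norms on the phase space -/

/-- The sum of the norms of the components that enter the energy norm. -/
noncomputable def sumNorm {L : ℝ} (X : PhaseSpace L) : ℝ :=
  ‖X.U‖ + ‖weakDeriv (-L) 0 X.u‖ + ‖X.V‖ + ‖weakDeriv 0 L X.v‖ + ‖X.φ₁‖ + ‖X.φ₂‖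

/-- With `exists_sumNorm_le` this is an equivalence of norms, which lets the resolvent be estimated
component by component. -/
theorem exists_energyNorm_le {ρ₁ ρ₂ k₁ k₂ α : ℝ} (L : ℝ) (hρ₁ : 0 < ρ₁) (hρ₂ : 0 < ρ₂)
    (hk₁ : 0 < k₁) (hk₂ : 0 < k₂) (hα : α ∈ Ioo (0 : ℝ) 1) : ∃ A : ℝ, 0 ≤ A ∧
      ∀ X : PhaseSpace L, energyNorm L ρ₁ ρ₂ k₁ k₂ α X ≤ A * sumNorm X := by
  have hC := frakC_pos hα
  refine ⟨Real.sqrt (ρ₁ + k₁ + ρ₂ + k₂ + frakC α + frakC α), Real.sqrt_nonneg _, fun X => ?_⟩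
  have hS : 0 ≤ sumNorm X := by unfold sumNorm; positivity
  rw [← Real.sqrt_sq hS, ← Real.sqrt_mul (by positivity), energyNorm]
  refine Real.sqrt_le_sqrt ?_
  simp only [add_mul]
  unfold sumNorm
  gcongr <;> linarith [norm_nonneg X.U, norm_nonneg (weakDeriv (-L) 0 X.u), norm_nonneg X.V,
    norm_nonneg (weakDeriv 0 L X.v), norm_nonneg X.φ₁, norm_nonneg X.φ₂]

theorem exists_sumNorm_le {ρ₁ ρ₂ k₁ k₂ α : ℝ} (L : ℝ) (hρ₁ : 0 < ρ₁) (hρ₂ : 0 < ρ₂)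
    (hk₁ : 0 < k₁) (hk₂ : 0 < k₂) (hα : α ∈ Ioo (0 : ℝ) 1) : ∃ B : ℝ, 0 ≤ B ∧
      ∀ X : PhaseSpace L, sumNorm X ≤ B * energyNorm L ρ₁ ρ₂ k₁ k₂ α X := by
  have hC := frakC_pos hα
  have key : ∀ c x y : ℝ, 0 < c → 0 ≤ x → c * x ^ 2 ≤ y →
      x ≤ (Real.sqrt c)⁻¹ * Real.sqrt y := by
    intro c x y hc hx h
    rw [inv_mul_eq_div, le_div_iff₀ (Real.sqrt_pos.2 hc)]
    refine Real.le_sqrt_of_sq_le ?_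
    rw [mul_pow, Real.sq_sqrt hc.le, mul_comm]
    exact h
  refine ⟨(Real.sqrt ρ₁)⁻¹ + (Real.sqrt k₁)⁻¹ + (Real.sqrt ρ₂)⁻¹ + (Real.sqrt k₂)⁻¹
    + (Real.sqrt (frakC α))⁻¹ + (Real.sqrt (frakC α))⁻¹, by positivity, fun X => ?_⟩
  simp only [add_mul]
  have p1 : 0 ≤ ρ₁ * ‖X.U‖ ^ 2 := by positivity
  have p2 : 0 ≤ k₁ * ‖weakDeriv (-L) 0 X.u‖ ^ 2 := by positivity
  have p3 : 0 ≤ ρ₂ * ‖X.V‖ ^ 2 := by positivity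
  have p4 : 0 ≤ k₂ * ‖weakDeriv 0 L X.v‖ ^ 2 := by positivity
  have p5 : 0 ≤ frakC α * ‖X.φ₁‖ ^ 2 := by positivity
  have p6 : 0 ≤ frakC α * ‖X.φ₂‖ ^ 2 := by positivity
  unfold sumNorm energyNorm
  refine add_le_add (add_le_add (add_le_add (add_le_add (add_le_add ?_ ?_) ?_) ?_) ?_) ?_
  all_goals refine key _ _ _ (by assumption) (norm_nonneg _) (by linarith)

/-! ### The resolvent equation -/

section Resolvent

variable {L ρ₁ ρ₂ k₁ k₂ α η lam : ℝ}

theorem toLp_memoryRate_iff {a b : ℝ} (hη : 0 ≤ η) (hne : η ≠ 0 ∨ lam ≠ 0) {φ h : LL2 a b}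
    {W : L2 a b} (hm : MemLp (memoryRate α η φ W) 2 volume) :
    (Complex.I * lam) • φ - hm.toLp _ = h ↔ IsMemorySolution α η lam φ h W := by
  rw [isMemorySolution_iff hη hne]
  constructor
  · rintro rfl
    filter_upwards [Lp.coeFn_sub ((Complex.I * lam) • φ) (hm.toLp _),
      Lp.coeFn_smul (Complex.I * lam) φ, hm.coeFn_toLp] with ξ e1 e2 e3
    rw [e1, Pi.sub_apply, e2, e3, Pi.smul_apply, sub_sub_cancel]
  · intro H
    refine Lp.ext ?_
    filter_upwards [Lp.coeFn_sub ((Complex.I * lam) • φ) (hm.toLp _),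
      Lp.coeFn_smul (Complex.I * lam) φ, hm.coeFn_toLp, H] with ξ e1 e2 e3 e4
    rw [e1, Pi.sub_apply, e2, e3, e4, Pi.smul_apply, sub_sub_cancel]

theorem exists_sumNorm_bound (hL : 0 < L) (hρ₁ : 0 < ρ₁) (hρ₂ : 0 < ρ₂) (hk₁ : 0 < k₁)
    (hk₂ : 0 < k₂) (hα : α ∈ Ioo (0 : ℝ) 1) (hη : 0 ≤ η) (hne : η ≠ 0 ∨ lam ≠ 0) :
    ∃ K : ℝ, 0 ≤ K ∧ ∀ X : (opA L ρ₁ ρ₂ k₁ k₂ α η hα).domain,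
      sumNorm (X : PhaseSpace L) ≤
        K * sumNorm (shift (opA L ρ₁ ρ₂ k₁ k₂ α η hα) (Complex.I * lam) X) := by
  have hL' : -L < 0 := by linarith
  obtain ⟨ζ, hζ, hζ₁, hζ₂⟩ := exists_rotation (ρ₁ := ρ₁) (ρ₂ := ρ₂) hα hη hne
  obtain ⟨K, hK, T⟩ := exists_transmission_bound hL hk₁ hk₂ hζ hζ₁ hζ₂
  obtain ⟨P₁, hP₁, Q₁⟩ := exists_poincare hL'
  obtain ⟨P₂, hP₂, Q₂⟩ := exists_poincare hL
  obtain ⟨A₁, hA₁, B₁⟩ := exists_reduced_rhs (a := -L) (b := 0) (k := k₁) hρ₁ hα hη hne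
  obtain ⟨A₂, hA₂, B₂⟩ := exists_reduced_rhs (a := 0) (b := L) (k := k₂) hρ₂ hα hη hne
  obtain ⟨M₁, hM₁, N₁⟩ := exists_isMemorySolution_bound (a := -L) (b := 0) hα hη hne
  obtain ⟨M₂, hM₂, N₂⟩ := exists_isMemorySolution_bound (a := 0) (b := L) hα hη hne
  -- `D` bounds the derivatives of the displacements: `P + 2` collects `‖f‖ ≤ P S`, `‖F‖ ≤ S` and
  -- `‖h‖ ≤ S`. `E₁`, `E₂` bound the velocities through `U = iλu - f`.
  set D := K * (A₁ * (P₁ + 2) + A₂ * (P₂ + 2)) with hD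
  set E₁ := |lam| * (P₁ * D) + P₁ with hE₁
  set E₂ := |lam| * (P₂ * D) + P₂ with hE₂
  have hD0 : 0 ≤ D := by positivity
  have hE₁0 : 0 ≤ E₁ := by positivity
  have hE₂0 : 0 ≤ E₂ := by positivity
  refine ⟨E₁ + D + E₂ + D + M₁ * (1 + E₁) + M₂ * (1 + E₂), by positivity, fun X => ?_⟩
  set Y := shift (opA L ρ₁ ρ₂ k₁ k₂ α η hα) (Complex.I * lam) X with hY
  obtain ⟨X, hX⟩ := X
  have eu : (Complex.I * lam) • X.u.1 - X.U = Y.u.1 := rfl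
  have ev : (Complex.I * lam) • X.v.1 - X.V = Y.v.1 := rfl
  have eU : (Complex.I * lam) • X.U - ρ₁⁻¹ • (k₁ • deriv2 (-L) 0 ⟨X.u, hX.2.1⟩
      - frakC α • memoryOutput α X.φ₁) = Y.U := rfl
  have eV : (Complex.I * lam) • X.V - ρ₂⁻¹ • (k₂ • deriv2 0 L ⟨X.v, hX.2.2.1⟩
      - frakC α • memoryOutput α X.φ₂) = Y.V := rfl
  have eφ₁ : (Complex.I * lam) • X.φ₁ - hX.2.2.2.2.1.2.toLp _ = Y.φ₁ := rfl
  have eφ₂ : (Complex.I * lam) • X.φ₂ - hX.2.2.2.2.2.2.toLp _ = Y.φ₂ := rfl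
  rw [toLp_memoryRate_iff hη hne] at eφ₁ eφ₂
  have eu' : X.U = (Complex.I * lam) • X.u.1 - Y.u.1 := by rw [← eu]; abel
  have ev' : X.V = (Complex.I * lam) • X.v.1 - Y.v.1 := by rw [← ev]; abel
  obtain ⟨r₁, hr₁, R₁⟩ := B₁ Y.u.1 Y.U Y.φ₁
  obtain ⟨r₂, hr₂, R₂⟩ := B₂ Y.v.1 Y.V Y.φ₂
  have s₁ := (R₁ X.u.1 (deriv2 (-L) 0 ⟨X.u, hX.2.1⟩) X.φ₁ (eu' ▸ eφ₁)).1 (eu' ▸ eU)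
  have s₂ := (R₂ X.v.1 (deriv2 0 L ⟨X.v, hX.2.2.1⟩) X.φ₂ (ev' ▸ eφ₂)).1 (ev' ▸ eV)
  have hp : IsTransmissionPair L k₁ k₂ X.u.1 (weakDeriv (-L) 0 X.u) (deriv2 (-L) 0 ⟨X.u, hX.2.1⟩)
      X.v.1 (weakDeriv 0 L X.v) (deriv2 0 L ⟨X.v, hX.2.2.1⟩) :=
    { du := weakDeriv_spec _
      dw := deriv2_spec ⟨X.u, hX.2.1⟩
      dv := weakDeriv_spec _
      dz := deriv2_spec ⟨X.v, hX.2.2.1⟩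
      left := X.uv.2.2.2.1
      right := X.uv.2.2.2.2.1
      cont := X.uv.2.2.2.2.2
      flux := hX.2.2.2.1 }
  have ml : -L ∈ Icc (-L) 0 := left_mem_Icc.2 hL'.le
  have mr : L ∈ Icc 0 L := right_mem_Icc.2 hL.le
  set S := sumNorm Y with hS
  have nU := norm_nonneg Y.U
  have nu := norm_nonneg (weakDeriv (-L) 0 Y.u)
  have nV := norm_nonneg Y.V
  have nv := norm_nonneg (weakDeriv 0 L Y.v)
  have n₁ := norm_nonneg Y.φ₁
  have n₂ := norm_nonneg Y.φ₂
  rw [sumNorm] at hS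
  have hS0 : 0 ≤ S := by rw [hS]; positivity
  have f₁ : ‖Y.u.1‖ ≤ P₁ * S :=
    (Q₁ _ _ _ ml (weakDeriv_spec Y.u) Y.uv.2.2.2.1).trans (by gcongr; linarith)
  have f₂ : ‖Y.v.1‖ ≤ P₂ * S :=
    (Q₂ _ _ _ mr (weakDeriv_spec Y.v) Y.uv.2.2.2.2.1).trans (by gcongr; linarith)
  have g₁ : ‖r₁‖ ≤ A₁ * (P₁ + 2) * S := by
    rw [mul_assoc]
    exact hr₁.trans (by gcongr; linarith)
  have g₂ : ‖r₂‖ ≤ A₂ * (P₂ + 2) * S := by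
    rw [mul_assoc]
    exact hr₂.trans (by gcongr; linarith)
  have wz : ‖weakDeriv (-L) 0 X.u‖ + ‖weakDeriv 0 L X.v‖ ≤ D * S := by
    refine (T _ _ _ _ _ _ r₁ r₂ hp s₁ s₂).trans ?_
    rw [hD, mul_assoc]
    gcongr
    linarith
  have w₁ : ‖weakDeriv (-L) 0 X.u‖ ≤ D * S := by linarith [norm_nonneg (weakDeriv 0 L X.v)]
  have w₂ : ‖weakDeriv 0 L X.v‖ ≤ D * S := by linarith [norm_nonneg (weakDeriv (-L) 0 X.u)]
  have hnl : ‖Complex.I * (lam : ℂ)‖ = |lam| := by simp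
  have U₁ : ‖X.U‖ ≤ E₁ * S := by
    rw [eu', hE₁]
    refine (norm_sub_le _ _).trans ?_
    rw [norm_smul, hnl, add_mul, mul_assoc, mul_assoc]
    gcongr
    exact (Q₁ _ _ _ ml hp.du hp.left).trans (by gcongr)
  have U₂ : ‖X.V‖ ≤ E₂ * S := by
    rw [ev', hE₂]
    refine (norm_sub_le _ _).trans ?_
    rw [norm_smul, hnl, add_mul, mul_assoc, mul_assoc]
    gcongr
    exact (Q₂ _ _ _ mr hp.dv hp.right).trans (by gcongr)
  have m₁ : ‖X.φ₁‖ ≤ M₁ * (1 + E₁) * S := by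
    -- The memory variable must be the constructed solution, by uniqueness, and so inherits its
    -- bound.
    obtain ⟨ψ, hψ, hb⟩ := N₁ Y.φ₁ X.U
    rw [eφ₁.unique hψ, mul_assoc]
    exact hb.trans (by gcongr; linarith)
  have m₂ : ‖X.φ₂‖ ≤ M₂ * (1 + E₂) * S := by
    obtain ⟨ψ, hψ, hb⟩ := N₂ Y.φ₂ X.V
    rw [eφ₂.unique hψ, mul_assoc]
    exact hb.trans (by gcongr; linarith)
  change ‖X.U‖ + ‖weakDeriv (-L) 0 X.u‖ + ‖X.V‖ + ‖weakDeriv 0 L X.v‖ + ‖X.φ₁‖ + ‖X.φ₂‖ ≤ _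
  simp only [add_mul _ _ S]
  linarith

/-- The norm sees displacements only through their derivatives; the Poincaré inequality recovers
them from the outer boundary conditions. -/
theorem eq_zero_of_sumNorm_le_zero (hL : 0 < L) {X : PhaseSpace L} (h : sumNorm X ≤ 0) :
    X = 0 := by
  have hL' : -L < 0 := by linarith
  rw [sumNorm] at h
  have nU := norm_nonneg X.U
  have nu := norm_nonneg (weakDeriv (-L) 0 X.u)
  have nV := norm_nonneg X.V
  have nv := norm_nonneg (weakDeriv 0 L X.v)
  have n₁ := norm_nonneg X.φ₁
  have n₂ := norm_nonneg X.φ₂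
  obtain ⟨P₁, -, Q₁⟩ := exists_poincare hL'
  obtain ⟨P₂, -, Q₂⟩ := exists_poincare hL
  have eu : ‖weakDeriv (-L) 0 X.u‖ = 0 := by linarith
  have ev : ‖weakDeriv 0 L X.v‖ = 0 := by linarith
  have fu := Q₁ _ _ _ (left_mem_Icc.2 hL'.le) (weakDeriv_spec X.u) X.uv.2.2.2.1
  have fv := Q₂ _ _ _ (right_mem_Icc.2 hL.le) (weakDeriv_spec X.v) X.uv.2.2.2.2.1
  rw [eu, mul_zero] at fu
  rw [ev, mul_zero] at fv
  have gU : X.U = 0 := norm_le_zero_iff.1 (by linarith)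
  have gV : X.V = 0 := norm_le_zero_iff.1 (by linarith)
  have g₁ : X.φ₁ = 0 := norm_le_zero_iff.1 (by linarith)
  have g₂ : X.φ₂ = 0 := norm_le_zero_iff.1 (by linarith)
  exact Prod.ext (Subtype.ext (Prod.ext (norm_le_zero_iff.1 fu) (norm_le_zero_iff.1 fv)))
    (Prod.ext (Prod.ext gU gV) (Prod.ext g₁ g₂))

theorem shift_injective (hL : 0 < L) (hρ₁ : 0 < ρ₁) (hρ₂ : 0 < ρ₂) (hk₁ : 0 < k₁)
    (hk₂ : 0 < k₂) (hα : α ∈ Ioo (0 : ℝ) 1) (hη : 0 ≤ η) (hne : η ≠ 0 ∨ lam ≠ 0) :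
    Function.Injective (shift (opA L ρ₁ ρ₂ k₁ k₂ α η hα) (Complex.I * lam)) := by
  rw [injective_iff_map_eq_zero]
  intro X hX
  obtain ⟨K, -, H⟩ := exists_sumNorm_bound hL hρ₁ hρ₂ hk₁ hk₂ hα hη hne (lam := lam)
  have h := H X
  have h0 : sumNorm (0 : PhaseSpace L) = 0 := by simp [sumNorm]
  rw [hX, h0, mul_zero] at h
  exact Subtype.ext (eq_zero_of_sumNorm_le_zero hL h)

theorem shift_surjective (hL : 0 < L) (hρ₁ : 0 < ρ₁) (hρ₂ : 0 < ρ₂) (hk₁ : 0 < k₁)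
    (hk₂ : 0 < k₂) (hα : α ∈ Ioo (0 : ℝ) 1) (hη : 0 ≤ η) (hne : η ≠ 0 ∨ lam ≠ 0) :
    Function.Surjective (shift (opA L ρ₁ ρ₂ k₁ k₂ α η hα) (Complex.I * lam)) := by
  intro Y
  obtain ⟨ζ, hζ, hζ₁, hζ₂⟩ := exists_rotation (ρ₁ := ρ₁) (ρ₂ := ρ₂) hα hη hne
  obtain ⟨_, _, B₁⟩ := exists_reduced_rhs (a := -L) (b := 0) (k := k₁) hρ₁ hα hη hne
  obtain ⟨_, _, B₂⟩ := exists_reduced_rhs (a := 0) (b := L) (k := k₂) hρ₂ hα hη hne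
  obtain ⟨_, _, N₁⟩ := exists_isMemorySolution_bound (a := -L) (b := 0) hα hη hne
  obtain ⟨_, _, N₂⟩ := exists_isMemorySolution_bound (a := 0) (b := L) hα hη hne
  obtain ⟨r₁, -, R₁⟩ := B₁ Y.u.1 Y.U Y.φ₁
  obtain ⟨r₂, -, R₂⟩ := B₂ Y.v.1 Y.V Y.φ₂
  obtain ⟨u, w, w', v, z, z', hp, s₁, s₂⟩ :=
    exists_transmission_solution hL hk₁ hk₂ hζ hζ₁ hζ₂ r₁ r₂
  obtain ⟨φ, hφ, -⟩ := N₁ Y.φ₁ ((Complex.I * lam) • u - Y.u.1)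
  obtain ⟨ψ, hψ, -⟩ := N₂ Y.φ₂ ((Complex.I * lam) • v - Y.v.1)
  have muv : (u, v) ∈ H10 L := ⟨⟨w, hp.du⟩, ⟨z, hp.dv⟩, hp.left, hp.right, hp.cont⟩
  let X : PhaseSpace L := (⟨(u, v), muv⟩,
    ((Complex.I * lam) • u - Y.u.1, (Complex.I * lam) • v - Y.v.1), (φ, ψ))
  have du : weakDeriv (-L) 0 X.u = w := weakDeriv_eq hp.du
  have dv : weakDeriv 0 L X.v = z := weakDeriv_eq hp.dv
  have hu : X.u ∈ H2 (-L) 0 := by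
    change weakDeriv (-L) 0 X.u ∈ H1 (-L) 0
    rw [du]
    exact ⟨w', hp.dw⟩
  have hv : X.v ∈ H2 0 L := by
    change weakDeriv 0 L X.v ∈ H1 0 L
    rw [dv]
    exact ⟨z', hp.dz⟩
  have hX : X ∈ domainA L k₁ k₂ α η := by
    refine ⟨?_, hu, hv, ?_, hφ.memoryCond hα hη hne, hψ.memoryCond hα hη hne⟩
    -- The velocities inherit the boundary and interface conditions, being a combination of
    -- displacements and data in `H10`.
    · exact sub_mem (Submodule.smul_mem _ (Complex.I * lam : ℂ) muv) Y.uv.2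
    · rw [du, dv]
      exact hp.flux
  have du2 : deriv2 (-L) 0 ⟨X.u, hu⟩ = w' := deriv2_eq hp.du hp.dw
  have dv2 : deriv2 0 L ⟨X.v, hv⟩ = z' := deriv2_eq hp.dv hp.dz
  have t₁ := (R₁ u w' φ hφ).2 s₁
  have t₂ := (R₂ v z' ψ hψ).2 s₂
  rw [← du2] at t₁
  rw [← dv2] at t₂
  refine ⟨⟨X, hX⟩, Prod.ext (Subtype.ext (Prod.ext ?_ ?_)) (Prod.ext (Prod.ext t₁ t₂)
    (Prod.ext ((toLp_memoryRate_iff hη hne hX.2.2.2.2.1.2).2 hφ)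
      ((toLp_memoryRate_iff hη hne hX.2.2.2.2.2.2).2 hψ)))⟩
  · exact sub_sub_cancel ((Complex.I * (lam : ℂ)) • u) Y.u.1
  · exact sub_sub_cancel ((Complex.I * (lam : ℂ)) • v) Y.v.1

theorem surjective_and_notMem_opSpectrum (hL : 0 < L) (hρ₁ : 0 < ρ₁) (hρ₂ : 0 < ρ₂)
    (hk₁ : 0 < k₁) (hk₂ : 0 < k₂) (hα : α ∈ Ioo (0 : ℝ) 1) (hη : 0 ≤ η)
    (hne : η ≠ 0 ∨ lam ≠ 0) :
    Function.Surjective (shift (opA L ρ₁ ρ₂ k₁ k₂ α η hα) (Complex.I * lam)) ∧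
      Complex.I * lam ∉ opSpectrum (energyNorm L ρ₁ ρ₂ k₁ k₂ α)
        (opA L ρ₁ ρ₂ k₁ k₂ α η hα) := by
  have hs := shift_surjective hL hρ₁ hρ₂ hk₁ hk₂ hα hη hne (lam := lam)
  obtain ⟨A, hA, HA⟩ := exists_energyNorm_le L hρ₁ hρ₂ hk₁ hk₂ hα
  obtain ⟨B, -, HB⟩ := exists_sumNorm_le L hρ₁ hρ₂ hk₁ hk₂ hα
  obtain ⟨K, hK, H⟩ := exists_sumNorm_bound hL hρ₁ hρ₂ hk₁ hk₂ hα hη hne (lam := lam)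
  refine ⟨hs, not_not.2 ⟨⟨shift_injective hL hρ₁ hρ₂ hk₁ hk₂ hα hη hne, hs⟩,
    A * (K * B), fun X => ?_⟩⟩
  rw [mul_assoc, mul_assoc]
  exact (HA _).trans (mul_le_mul_of_nonneg_left
    ((H X).trans (mul_le_mul_of_nonneg_left (HB _) hK)) hA)

end Resolvent

end Transmission

/-- Both cases amount to `η ≠ 0` or `λ ≠ 0`, which is what keeps the symbol `iλ + η + ξ²` away from
zero at `ξ = 0`. -/
theorem mainTheorem5 (L ρ₁ ρ₂ k₁ k₂ α η : ℝ) (hL : 0 < L) (hρ₁ : 0 < ρ₁) (hρ₂ : 0 < ρ₂)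
    (hk₁ : 0 < k₁) (hk₂ : 0 < k₂) (hα : α ∈ Set.Ioo (0 : ℝ) 1) :
    (η = 0 → ∀ lam : ℝ, lam ≠ 0 →
      Function.Surjective
        (Transmission.shift (Transmission.opA L ρ₁ ρ₂ k₁ k₂ α η hα) (Complex.I * lam)) ∧
      Complex.I * lam ∉ Transmission.opSpectrum (Transmission.energyNorm L ρ₁ ρ₂ k₁ k₂ α)
        (Transmission.opA L ρ₁ ρ₂ k₁ k₂ α η hα)) ∧
    (0 < η → ∀ lam : ℝ,
      Function.Surjective
        (Transmission.shift (Transmission.opA L ρ₁ ρ₂ k₁ k₂ α η hα) (Complex.I * lam)) ∧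
      Complex.I * lam ∉ Transmission.opSpectrum (Transmission.energyNorm L ρ₁ ρ₂ k₁ k₂ α)
        (Transmission.opA L ρ₁ ρ₂ k₁ k₂ α η hα)) :=
  ⟨fun hη _ hl => Transmission.surjective_and_notMem_opSpectrum hL hρ₁ hρ₂ hk₁ hk₂ hα hη.ge
      (Or.inr hl),
    fun hη _ => Transmission.surjective_and_notMem_opSpectrum hL hρ₁ hρ₂ hk₁ hk₂ hα hη.le
      (Or.inl hη.ne')⟩
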